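/- Let $d\ge 1$, let $|x|=\sum_i|x_i|$ and $\langle x,y\rangle=\sum_i x_iy_i$ on $\mathbb R^d$, and let $\|\cdot\|$ be the operator norm on $d\times d$ matrices associated with $|\cdot|$. Let $N$ be a random nonnegative integer and $A_1,A_2,\dots$ random $d\times d$ real matrices, defined on the same probability space. Assume the following. (A) $N\ge 1$ a.s., $1<\mathbb E[N]<\infty$, and a.s. all $A_i$ have nonnegative entries, $A_i\neq 0$ for $1\le i\le N$, and $A_i=0$ for $i>N$. (B) Let $\mu$ be the probability measure on matrices given by $\int f\,d\mu=\frac1{\mathbb E[N]}\mathbb E\big[\sum_{i=1}^N f(A_i)\big]$, let $M_1,M_2,\dots$ be i.i.d. with law $\mu$, put $I_\mu=\{s\ge 0:\int\|a\|^s\mu(da)<\infty\}$ and, for $s\in I_\mu$, $\kappa(s)=\lim_{n\to\infty}\big(\mathbb E\|M_n\cdots M_1\|^s\big)^{1/n}$ and $m(s)=\mathbb E[N]\,\kappa(s)$. There is $\alpha\in(0,1]\cap\mathrm{int}(I_\mu)$ with $m(\alpha)=1$ and $m'(\alpha)<0$. (C) With $N(t)=\#\{i\ge1: A_i^{T}t\ne0\}$: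 almost surely $N(t)\ge1$ for all $t\in\mathbb R^d\setminus\{0\}$; $\mathbb P[N(t)=1]<1$ for every $t\in\mathbb R^d\setminus\{0\}$; and there are $\varepsilon_0>0$ and, for each $t$ with $|t|=1$, a random index $i(t)\ge1$ with $A_{i(t)}^{T}t\neq0$ a.s., such that $\sup_{|t|=1}\mathbb E\big[|A_{i(t)}^{T}t|^{-\varepsilon_0}\big]<\infty$. Let $Z$ be an $\mathbb R_+^d$-valued random vector with $\mathbb P[Z=0]=0$ which satisfies $Z\overset{\mathcal L}{=}\sum_{i=1}^N A_iZ_i$, where $Z_1,Z_2,\dots$ are i.i.d. copies of $Z$, independent of $(N,A_1,A_2,\dots)$. 1. If $Z$ is not almost surely contained in a fixed affine hyperplane (that is, $\langle t,Z\rangle$ is not a.s. constant for any $t\neq0$), then there are constants $a>0$ and $C>0$ such that $$\big|\mathbb E\, e^{i\langle t,Z\rangle}\big|\le C|t|^{-a}\qquad\text{for all }t\in\mathbb R^d\setminus\{0\}.$$ 2. If there are linearly independent vectors $v_1,\dots,v_d\in\mathbb R_+^d\setminus\{0\}$ with $\mathbb R_+v_i\subset\mathrm{supp}(Z)$ for $i=1,\dots,d$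 (in which case $Z$ also satisfies the hypothesis of part 1), then the law of $Z$ is absolutely continuous with respect to Lebesgue measure on $\mathbb R^d$. -/

import Mathlib

open MeasureTheory ProbabilityTheory Filter Topology
open scoped ENNReal Matrix

noncomputable section

namespace Smoothing

/-- Matrices carry the product (= Borel) σ-algebra of their entries. -/
instance instMeasurableSpaceMatrix {d : ℕ} : MeasurableSpace (Matrix (Fin d) (Fin d) ℝ) :=
  inferInstanceAs (MeasurableSpace (Fin d → Fin d → ℝ))

instance instBorelSpaceMatrix {d : ℕ} : BorelSpace (Matrix (Fin d) (Fin d) ℝ) :=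
  inferInstanceAs (BorelSpace (Fin d → Fin d → ℝ))

/-- The `L¹` norm `|x| = ∑ |x_i|` of a vector. -/
def l1norm {d : ℕ} (x : Fin d → ℝ) : ℝ := ∑ i, |x i|

/-- The operator norm of a matrix acting on `ℝ^d` with the `L¹` norm. -/
def opNorm {d : ℕ} (a : Matrix (Fin d) (Fin d) ℝ) : ℝ :=
  ‖LinearMap.toContinuousLinearMap (Matrix.toLpLin 1 1 a)‖

variable {Ω : Type*} [MeasurableSpace Ω] {d : ℕ}

/-- `E[N]`. -/
def meanN (P : Measure Ω) (N : Ω → ℕ) : ℝ := ∫ ω, (N ω : ℝ) ∂P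

/-- `N ≥ 1` a.s., `E[N] ∈ (1, ∞)`, the matrices are nonnegative, the first `N` of them are nonzero
and the others vanish. The matrix `A i` is the one usually written `A_{i+1}`. -/
structure BranchingCondition (P : Measure Ω) (N : Ω → ℕ)
    (A : ℕ → Ω → Matrix (Fin d) (Fin d) ℝ) : Prop where
  one_le : ∀ᵐ ω ∂P, 1 ≤ N ω
  integrable : Integrable (fun ω => (N ω : ℝ)) P
  one_lt_mean : 1 < meanN P N
  nonneg : ∀ᵐ ω ∂P, ∀ i j k, 0 ≤ A i ω j k
  ne_zero : ∀ᵐ ω ∂P, ∀ i, i < N ω → A i ω ≠ 0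
  eq_zero : ∀ᵐ ω ∂P, ∀ i, N ω ≤ i → A i ω = 0

/-- The measure `μ` on matrices with `∫ f dμ = E[N]⁻¹ E[∑_{i=1}^N f(A_i)]`. -/
def intensity (P : Measure Ω) (N : Ω → ℕ) (A : ℕ → Ω → Matrix (Fin d) (Fin d) ℝ) :
    Measure (Matrix (Fin d) (Fin d) ℝ) :=
  (ENNReal.ofReal (meanN P N))⁻¹ •
    Measure.sum (fun i => (P.restrict {ω | i < N ω}).map (A i))

/-- `I_μ = {s ≥ 0 : ∫ ‖a‖^s μ(da) < ∞}`. -/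
def momentSet (μ : Measure (Matrix (Fin d) (Fin d) ℝ)) : Set ℝ :=
  {s | 0 ≤ s ∧ ∫⁻ a, ENNReal.ofReal (opNorm a) ^ s ∂μ < ∞}

/-- `E ‖M_n ⋯ M_1‖^s` for i.i.d. `M_1, …, M_n` with law `μ`. -/
def productMoment (μ : Measure (Matrix (Fin d) (Fin d) ℝ)) (s : ℝ) (n : ℕ) : ℝ≥0∞ :=
  ∫⁻ M : Fin n → Matrix (Fin d) (Fin d) ℝ,
    ENNReal.ofReal (opNorm (List.ofFn M).reverse.prod) ^ s ∂(Measure.pi fun _ => μ)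

/-- `κ(s) = lim_n (E ‖M_n ⋯ M_1‖^s)^{1/n}`; the limit exists for `s ∈ I_μ` by submultiplicativity. -/
def kappa (μ : Measure (Matrix (Fin d) (Fin d) ℝ)) (s : ℝ) : ℝ :=
  limUnder atTop (fun n : ℕ => (productMoment μ s n).toReal ^ (1 / (n : ℝ)))

/-- `m(s) = E[N] κ(s)`. -/
def mFun (P : Measure Ω) (N : Ω → ℕ) (A : ℕ → Ω → Matrix (Fin d) (Fin d) ℝ) (s : ℝ) : ℝ :=
  meanN P N * kappa (intensity P N A) s

/-- There is `α ∈ (0,1] ∩ int I_μ` with `m(α) = 1` and `m'(α) < 0`. (A nonzero value of `deriv`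
includes differentiability.) -/
def AlphaCondition (P : Measure Ω) (N : Ω → ℕ) (A : ℕ → Ω → Matrix (Fin d) (Fin d) ℝ) : Prop :=
  ∃ α ∈ Set.Ioc (0 : ℝ) 1 ∩ interior (momentSet (intensity P N A)),
    mFun P N A α = 1 ∧ deriv (mFun P N A) α < 0

/-- `N(t) = #{i : A_iᵀ t ≠ 0}`. -/
def activeCount (A : ℕ → Ω → Matrix (Fin d) (Fin d) ℝ) (t : Fin d → ℝ) (ω : Ω) : ℕ∞ :=
  {i : ℕ | (A i ω)ᵀ *ᵥ t ≠ 0}.encard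

/-- A.s. `N(t) ≥ 1` for all `t ≠ 0`; `P[N(t) = 1] < 1` for each `t ≠ 0`; and for some `ε₀ > 0` and
some random indices `i(t)` with `A_{i(t)}ᵀ t ≠ 0` a.s., the moments `E |A_{i(t)}ᵀ t|^{-ε₀}` are
bounded uniformly over the unit sphere. -/
structure ActivityCondition (P : Measure Ω) (A : ℕ → Ω → Matrix (Fin d) (Fin d) ℝ) :
    Prop where
  one_le : ∀ᵐ ω ∂P, ∀ t : Fin d → ℝ, t ≠ 0 → 1 ≤ activeCount A t ω
  prob_lt_one : ∀ t : Fin d → ℝ, t ≠ 0 → P {ω | activeCount A t ω = 1} < 1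
  harmonic : ∃ ε₀ : ℝ, 0 < ε₀ ∧ ∃ i : (Fin d → ℝ) → Ω → ℕ,
    (∀ t, l1norm t = 1 → Measurable (i t) ∧ ∀ᵐ ω ∂P, (A (i t ω) ω)ᵀ *ᵥ t ≠ 0) ∧
    (⨆ t ∈ {t : Fin d → ℝ | l1norm t = 1},
      ∫⁻ ω, ENNReal.ofReal (l1norm ((A (i t ω) ω)ᵀ *ᵥ t)) ^ (-ε₀) ∂P) < ∞

/-- The smoothing transform: the law of `∑_{i=1}^N A_i Z_i`, where the `Z_i` are i.i.d. with law
`η` and independent of `(N, A_1, A_2, …)`. -/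
def smoothingTransform (P : Measure Ω) (N : Ω → ℕ) (A : ℕ → Ω → Matrix (Fin d) (Fin d) ℝ)
    (η : Measure (Fin d → ℝ)) : Measure (Fin d → ℝ) :=
  (P.prod (Measure.infinitePi fun _ : ℕ => η)).map
    (fun p => ∑ i ∈ Finset.range (N p.1), A i p.1 *ᵥ p.2 i)

end Smoothing

end

/-!
Since `m(s) < 1` for some `s > 0`, there is a Lyapunov function `w t`, comparable to `|t| ^ s` and
contracted in mean when `t` is replaced by the collection of its children `A_iᵀ t`. Write `φ` for
the characteristic function of `Z`. The fixed point equation bounds `|φ t|` by the mean of the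
product of `|φ|` over the children of `t`, hence by the mean of `|φ|` at any single randomly chosen
child. As `w` contracts in mean along such children, `|φ| = 1` at some `t ≠ 0` would give a sequence
of points tending to `0` at which `|φ| = 1`, and a limiting direction of this sequence is one in
which `Z` is almost surely constant. So a nondegenerate law has `|φ| < 1` off `0`, and correcting
`|φ|` by a negative power of `w` turns the same argument into a bound away from `1` outside a ball.
As two children of a large `t` are large with positive probability, the extra factor turns the
recursive inequality into polynomial decay of `φ`.

For absolute continuity consider the sums `C_1 Z_1 + ⋯ + C_k Z_k` of linear images of independent
copies of `Z`. For surjective `C_i` and large `k` the characteristic function is integrable by the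
polynomial decay. Replacing one summand by its children adds a term with positive probability, so
the singular mass of `k` terms is at most a fixed fraction of itself once `k + 1` terms have none,
which brings `k` down to `1`. The children may have images of smaller rank; these are handled by
induction on the dimension, slicing along the subspace carrying one summand.
-/

noncomputable section

namespace Smoothing

section Norms

variable {d : ℕ}

lemma l1norm_nonneg (x : Fin d → ℝ) : 0 ≤ l1norm x :=
  Finset.sum_nonneg fun _ _ => abs_nonneg _

lemma l1norm_eq_zero {x : Fin d → ℝ} : l1norm x = 0 ↔ x = 0 := by
  rw [l1norm, Finset.sum_eq_zero_iff_of_nonneg fun _ _ => abs_nonneg _]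
  simp [funext_iff]

lemma l1norm_pos {x : Fin d → ℝ} (hx : x ≠ 0) : 0 < l1norm x :=
  (l1norm_nonneg x).lt_of_ne fun h => hx (l1norm_eq_zero.1 h.symm)

lemma ne_zero_of_one_le_l1norm {x : Fin d → ℝ} (hx : 1 ≤ l1norm x) : x ≠ 0 :=
  fun h => by linarith [l1norm_eq_zero.2 h]

lemma l1norm_smul (c : ℝ) (x : Fin d → ℝ) : l1norm (c • x) = |c| * l1norm x := by
  simp [l1norm, abs_mul, Finset.mul_sum]

lemma l1norm_normalize {t : Fin d → ℝ} (ht : t ≠ 0) : l1norm ((l1norm t)⁻¹ • t) = 1 := by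
  rw [l1norm_smul, abs_of_pos (inv_pos.2 (l1norm_pos ht)), inv_mul_cancel₀ (l1norm_pos ht).ne']

lemma l1norm_single_one (j : Fin d) : l1norm (Pi.single j (1 : ℝ)) = 1 := by
  rw [l1norm, Finset.sum_eq_single j] <;> simp +contextual

lemma continuous_l1norm : Continuous (l1norm : (Fin d → ℝ) → ℝ) := by
  unfold l1norm
  fun_prop

lemma abs_apply_le_l1norm (x : Fin d → ℝ) (i : Fin d) : |x i| ≤ l1norm x :=
  Finset.single_le_sum (f := fun i => |x i|) (fun _ _ => abs_nonneg _) (Finset.mem_univ i)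

lemma abs_dotProduct_le (x y : Fin d → ℝ) : |x ⬝ᵥ y| ≤ l1norm x * l1norm y :=
  calc |x ⬝ᵥ y| ≤ ∑ i, |x i * y i| := Finset.abs_sum_le_sum_abs _ _
    _ ≤ ∑ i, |x i| * l1norm y := Finset.sum_le_sum fun i _ => by
      rw [abs_mul]
      exact mul_le_mul_of_nonneg_left (abs_apply_le_l1norm y i) (abs_nonneg _)
    _ = l1norm x * l1norm y := (Finset.sum_mul _ _ _).symm

lemma isCompact_l1norm_annulus (a b : ℝ) :
    IsCompact {t : Fin d → ℝ | a ≤ l1norm t ∧ l1norm t ≤ b} := by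
  refine (isCompact_closedBall (0 : Fin d → ℝ) b).of_isClosed_subset
    ((isClosed_le continuous_const continuous_l1norm).inter
      (isClosed_le continuous_l1norm continuous_const)) fun t ⟨_, htb⟩ => ?_
  rw [mem_closedBall_zero_iff, pi_norm_le_iff_of_nonneg ((l1norm_nonneg t).trans htb)]
  exact fun i => (abs_apply_le_l1norm t i).trans htb

lemma opNorm_nonneg (a : Matrix (Fin d) (Fin d) ℝ) : 0 ≤ opNorm a := norm_nonneg _

lemma opNorm_mul_le (a b : Matrix (Fin d) (Fin d) ℝ) : opNorm (a * b) ≤ opNorm a * opNorm b := by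
  simp only [opNorm, Matrix.toLpLin_mul_same]
  exact ContinuousLinearMap.opNorm_comp_le (LinearMap.toContinuousLinearMap (Matrix.toLpLin 1 1 a))
    (LinearMap.toContinuousLinearMap (Matrix.toLpLin 1 1 b))

lemma continuous_opNorm : Continuous (opNorm : Matrix (Fin d) (Fin d) ℝ → ℝ) :=
  continuous_norm.comp <| LinearMap.continuous_of_finiteDimensional <|
    (LinearMap.toContinuousLinearMap :
      (WithLp 1 (Fin d → ℝ) →ₗ[ℝ] WithLp 1 (Fin d → ℝ)) ≃ₗ[ℝ] _).toLinearMap ∘ₗ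
      (Matrix.toLpLin 1 1 : Matrix (Fin d) (Fin d) ℝ ≃ₗ[ℝ] _).toLinearMap

lemma l1norm_mulVec_le (a : Matrix (Fin d) (Fin d) ℝ) (x : Fin d → ℝ) :
    l1norm (a *ᵥ x) ≤ opNorm a * l1norm x := by
  have norm_toLp (y : Fin d → ℝ) : ‖WithLp.toLp 1 y‖ = l1norm y := PiLp.norm_eq_of_L1 _
  have := (LinearMap.toContinuousLinearMap (Matrix.toLpLin 1 1 a)).le_opNorm (WithLp.toLp 1 x)
  simpa [Matrix.toLpLin_apply, norm_toLp, opNorm] using this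

lemma abs_transpose_mulVec_apply_le (a : Matrix (Fin d) (Fin d) ℝ) (t : Fin d → ℝ) (j : Fin d) :
    |(aᵀ *ᵥ t) j| ≤ opNorm a * l1norm t :=
  calc |(aᵀ *ᵥ t) j| = |(a *ᵥ Pi.single j 1) ⬝ᵥ t| := by rw [Matrix.mulVec_single_one]; rfl
    _ ≤ l1norm (a *ᵥ Pi.single j 1) * l1norm t := abs_dotProduct_le _ _
    _ ≤ opNorm a * l1norm t := by
      gcongr
      · exact l1norm_nonneg t
      · simpa only [l1norm_single_one, mul_one] using l1norm_mulVec_le a (Pi.single j 1)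

lemma l1norm_transpose_mulVec_le (a : Matrix (Fin d) (Fin d) ℝ) (t : Fin d → ℝ) :
    l1norm (aᵀ *ᵥ t) ≤ d * opNorm a * l1norm t :=
  calc l1norm (aᵀ *ᵥ t) ≤ ∑ _j : Fin d, opNorm a * l1norm t :=
        Finset.sum_le_sum fun j _ => abs_transpose_mulVec_apply_le a t j
    _ = d * opNorm a * l1norm t := by simp [mul_assoc]

instance instSecondCountableTopologyMatrix :
    SecondCountableTopology (Matrix (Fin d) (Fin d) ℝ) :=
  inferInstanceAs (SecondCountableTopology (Fin d → Fin d → ℝ))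

instance instMeasurableMul₂Matrix : MeasurableMul₂ (Matrix (Fin d) (Fin d) ℝ) :=
  ContinuousMul.measurableMul₂

lemma measurable_transpose_mulVec :
    Measurable fun p : Matrix (Fin d) (Fin d) ℝ × (Fin d → ℝ) => p.1ᵀ *ᵥ p.2 :=
  (continuous_fst.matrix_transpose.matrix_mulVec continuous_snd).measurable

lemma measurable_transpose_mulVec_const (t : Fin d → ℝ) :
    Measurable fun a : Matrix (Fin d) (Fin d) ℝ => aᵀ *ᵥ t :=
  measurable_transpose_mulVec.comp (measurable_id.prodMk measurable_const)

lemma measurable_opNorm_rpow (s : ℝ) :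
    Measurable fun a : Matrix (Fin d) (Fin d) ℝ => ENNReal.ofReal (opNorm a) ^ s :=
  (ENNReal.measurable_ofReal.comp continuous_opNorm.measurable).pow_const s

lemma measurable_l1norm_rpow (s : ℝ) :
    Measurable fun t : Fin d → ℝ => ENNReal.ofReal (l1norm t) ^ s :=
  (ENNReal.measurable_ofReal.comp continuous_l1norm.measurable).pow_const s

end Norms

section ProductLaw

variable {M : Type*} [Monoid M] [MeasurableSpace M]

/-- The law of the product of `n` independent elements of a monoid with common law `μ`, that is, the
`n`-fold multiplicative convolution power of `μ`. -/
def productLaw (μ : Measure M) : ℕ → Measure M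
  | 0 => Measure.dirac 1
  | n + 1 => μ ∗ₘ productLaw μ n

variable [MeasurableMul₂ M] (μ : Measure M) [IsProbabilityMeasure μ]

instance instIsProbabilityMeasureProductLaw (n : ℕ) : IsProbabilityMeasure (productLaw μ n) := by
  induction n with
  | zero => exact Measure.dirac.isProbabilityMeasure
  | succ n ih => exact Measure.probabilitymeasure_of_probabilitymeasures_mconv _ _

lemma productLaw_add (m n : ℕ) : productLaw μ (m + n) = productLaw μ m ∗ₘ productLaw μ n := by
  induction m with
  | zero => rw [Nat.zero_add, productLaw, Measure.dirac_one_mconv]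
  | succ m ih => rw [Nat.add_right_comm, productLaw, ih, ← Measure.mconv_assoc, productLaw]

lemma measurable_reverse_prod_ofFn (n : ℕ) :
    Measurable fun a : Fin n → M => (List.ofFn a).reverse.prod := by
  induction n with
  | zero => simp [measurable_const]
  | succ n ih =>
    simp only [List.ofFn_succ', List.concat_eq_append, List.reverse_append, List.reverse_singleton,
      List.singleton_append, List.prod_cons]
    exact (measurable_pi_apply _).mul
      (ih.comp (measurable_pi_lambda _ fun i => measurable_pi_apply _))

lemma map_reverse_prod_pi (n : ℕ) :
    (Measure.pi fun _ : Fin n => μ).map (fun a => (List.ofFn a).reverse.prod) =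
      productLaw μ n := by
  induction n with
  | zero => simp [productLaw]
  | succ n ih =>
    have split_last := measurePreserving_piFinSuccAbove (fun _ : Fin (n + 1) => μ) (Fin.last n)
    have prod_eq : (fun a : Fin (n + 1) → M => (List.ofFn a).reverse.prod) =
        (fun p : M × M => p.1 * p.2) ∘ Prod.map id (fun a => (List.ofFn a).reverse.prod) ∘
          MeasurableEquiv.piFinSuccAbove (fun _ => M) (Fin.last n) := by
      ext a
      rw [List.ofFn_succ', List.concat_eq_append, List.reverse_append, List.reverse_singleton,
        List.singleton_append, List.prod_cons]
      simp only [Function.comp_apply, Prod.map_apply, id_eq,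
        MeasurableEquiv.piFinSuccAbove_apply, Fin.insertNthEquiv_last, Fin.snocEquiv_symm_apply]
      rfl
    rw [prod_eq, ← Measure.map_map measurable_mul
        (.comp (measurable_id.prodMap (measurable_reverse_prod_ofFn n)) split_last.measurable),
      ← Measure.map_map (measurable_id.prodMap (measurable_reverse_prod_ofFn n))
        split_last.measurable,
      split_last.map_eq,
      ← Measure.map_prod_map _ _ measurable_id (measurable_reverse_prod_ofFn n), ih, Measure.map_id]
    rfl

end ProductLaw

section ProductMoment

variable {d : ℕ} (μ : Measure (Matrix (Fin d) (Fin d) ℝ)) [IsProbabilityMeasure μ]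

lemma productMoment_eq_lintegral_productLaw (s : ℝ) (n : ℕ) :
    productMoment μ s n = ∫⁻ a, ENNReal.ofReal (opNorm a) ^ s ∂(productLaw μ n) := by
  rw [← map_reverse_prod_pi, lintegral_map (measurable_opNorm_rpow s)
    (measurable_reverse_prod_ofFn n), productMoment]

lemma productMoment_add_le {s : ℝ} (hs : 0 ≤ s) (m n : ℕ) :
    productMoment μ s (m + n) ≤ productMoment μ s m * productMoment μ s n := by
  simp only [productMoment_eq_lintegral_productLaw, productLaw_add]
  calc ∫⁻ c, ENNReal.ofReal (opNorm c) ^ s ∂(productLaw μ m ∗ₘ productLaw μ n)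
      = ∫⁻ a, ∫⁻ b, ENNReal.ofReal (opNorm (a * b)) ^ s ∂(productLaw μ n) ∂(productLaw μ m) :=
        Measure.lintegral_mconv (measurable_opNorm_rpow s)
    _ ≤ ∫⁻ a, ∫⁻ b, ENNReal.ofReal (opNorm a) ^ s * ENNReal.ofReal (opNorm b) ^ s
          ∂(productLaw μ n) ∂(productLaw μ m) := by
        refine lintegral_mono fun a => lintegral_mono fun b => ?_
        rw [← ENNReal.mul_rpow_of_nonneg _ _ hs, ← ENNReal.ofReal_mul (opNorm_nonneg a)]
        exact ENNReal.rpow_le_rpow (ENNReal.ofReal_le_ofReal (opNorm_mul_le a b)) hs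
    _ = _ := lintegral_lintegral_mul (measurable_opNorm_rpow s).aemeasurable
        (measurable_opNorm_rpow s).aemeasurable

lemma productMoment_one (s : ℝ) :
    productMoment μ s 1 = ∫⁻ a, ENNReal.ofReal (opNorm a) ^ s ∂μ := by
  rw [productMoment_eq_lintegral_productLaw, productLaw, productLaw, Measure.mconv_dirac_one]

lemma productMoment_ne_top {s : ℝ} (hs : s ∈ momentSet μ) (n : ℕ) : productMoment μ s n ≠ ∞ := by
  obtain ⟨hs0, hfin⟩ := hs
  induction n with
  | zero => simp [productMoment, ENNReal.rpow_ne_top_of_nonneg hs0]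
  | succ n ih =>
    refine ((productMoment_add_le μ hs0 n 1).trans_lt (ENNReal.mul_lt_top ih.lt_top ?_)).ne
    rwa [productMoment_one]

end ProductMoment

/-! ### Fekete's lemma and the growth rate -/

section Kappa

lemma exists_tendsto_exp_div_of_subadditive {u : ℕ → ℝ} (hu : Subadditive u) :
    ∃ L, Tendsto (fun n : ℕ => Real.exp (u n / n)) atTop (𝓝 L) := by
  set S : Set ℝ := (fun n : ℕ => Real.exp (u n / n)) '' Set.Ici 1
  have bddBelow_S : BddBelow S := ⟨0, by rintro _ ⟨n, -, rfl⟩; positivity⟩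
  refine ⟨sInf S, tendsto_order.2 ⟨fun c hc => ?_, fun c hc => ?_⟩⟩
  · filter_upwards [eventually_ge_atTop 1] with n hn
    exact hc.trans_le (csInf_le bddBelow_S ⟨n, hn, rfl⟩)
  · obtain ⟨_, ⟨n, hn, rfl⟩, hlt⟩ := exists_lt_of_csInf_lt
      (Set.Nonempty.image _ ⟨1, Set.mem_Ici.2 le_rfl⟩) hc
    have hc_pos : 0 < c := (Real.exp_pos _).trans hlt
    filter_upwards [hu.eventually_div_lt_of_div_lt (Nat.one_le_iff_ne_zero.1 hn)
      ((Real.lt_log_iff_exp_lt hc_pos).2 hlt)] with p hp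
    exact (Real.lt_log_iff_exp_lt hc_pos).1 hp

lemma exists_tendsto_rpow_one_div_of_submultiplicative {v : ℕ → ℝ} (hv_nonneg : ∀ n, 0 ≤ v n)
    (hv : ∀ m n, v (m + n) ≤ v m * v n) :
    ∃ L, Tendsto (fun n : ℕ => v n ^ (1 / (n : ℝ))) atTop (𝓝 L) := by
  by_cases hzero : ∃ k, v k = 0
  · obtain ⟨k, hk⟩ := hzero
    refine ⟨0, tendsto_const_nhds.congr' ?_⟩
    filter_upwards [eventually_ge_atTop k, eventually_gt_atTop 0] with n hn hn_pos
    obtain ⟨j, rfl⟩ := Nat.exists_eq_add_of_le hn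
    have hv_zero : v (k + j) = 0 := ((hv k j).trans_eq (by simp [hk])).antisymm (hv_nonneg _)
    rw [hv_zero, Real.zero_rpow (by positivity)]
  · push Not at hzero
    have hv_pos (n : ℕ) : 0 < v n := (hv_nonneg n).lt_of_ne (hzero n).symm
    have log_subadditive : Subadditive fun n => Real.log (v n) := fun m n => by
      rw [← Real.log_mul (hv_pos m).ne' (hv_pos n).ne']
      exact Real.log_le_log (hv_pos _) (hv m n)
    have rpow_eq_exp (n : ℕ) : v n ^ (1 / (n : ℝ)) = Real.exp (Real.log (v n) / n) := by
      rw [Real.rpow_def_of_pos (hv_pos n), mul_one_div]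
    simpa only [rpow_eq_exp] using exists_tendsto_exp_div_of_subadditive log_subadditive

lemma eventually_le_pow_of_tendsto_rpow_one_div {v : ℕ → ℝ} (hv_nonneg : ∀ n, 0 ≤ v n)
    {L r : ℝ} (hv : Tendsto (fun n : ℕ => v n ^ (1 / (n : ℝ))) atTop (𝓝 L)) (hr : L < r) :
    ∀ᶠ n in atTop, v n ≤ r ^ n := by
  filter_upwards [hv.eventually (eventually_lt_nhds hr), eventually_ne_atTop 0] with n hn hn0
  have := pow_le_pow_left₀ (Real.rpow_nonneg (hv_nonneg n) _) hn.le n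
  rwa [one_div, Real.rpow_inv_natCast_pow (hv_nonneg n) hn0] at this

variable {d : ℕ} (μ : Measure (Matrix (Fin d) (Fin d) ℝ)) [IsProbabilityMeasure μ] {s : ℝ}

lemma tendsto_kappa (hs : s ∈ momentSet μ) :
    Tendsto (fun n : ℕ => (productMoment μ s n).toReal ^ (1 / (n : ℝ))) atTop (𝓝 (kappa μ s)) := by
  refine tendsto_nhds_limUnder <| exists_tendsto_rpow_one_div_of_submultiplicative
    (fun _ => ENNReal.toReal_nonneg) fun m n => ?_
  rw [← ENNReal.toReal_mul]
  exact ENNReal.toReal_mono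
    (ENNReal.mul_ne_top (productMoment_ne_top μ hs m) (productMoment_ne_top μ hs n))
    (productMoment_add_le μ hs.1 m n)

lemma exists_pow_mul_productMoment_le_one {m : ℝ} (hs : s ∈ momentSet μ) (hm : 0 < m)
    (hlt : m * kappa μ s < 1) {D : ℝ} (hD : 0 ≤ D) :
    ∃ q, m < q ∧ ∃ n : ℕ, q ^ (n + 1) * (D * (productMoment μ s (n + 1)).toReal) ≤ 1 := by
  have kappa_nonneg : 0 ≤ kappa μ s :=
    ge_of_tendsto' (tendsto_kappa μ hs) fun n => Real.rpow_nonneg ENNReal.toReal_nonneg _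
  obtain ⟨r, hr_gt, hr_lt⟩ := exists_between ((lt_div_iff₀' hm).2 hlt)
  have hr_pos : 0 < r := kappa_nonneg.trans_lt hr_gt
  obtain ⟨q, hq_gt, hq_lt⟩ := exists_between ((lt_one_div hr_pos hm).1 hr_lt)
  have hq_pos : 0 < q := hm.trans hq_gt
  have geometric : Tendsto (fun n : ℕ => D * (q * r) ^ n) atTop (𝓝 (D * 0)) :=
    (tendsto_pow_atTop_nhds_zero_of_lt_one (by positivity)
      ((lt_div_iff₀ hr_pos).1 hq_lt)).const_mul _
  rw [mul_zero] at geometric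
  have eventually_le := (eventually_le_pow_of_tendsto_rpow_one_div
    (fun _ => ENNReal.toReal_nonneg) (tendsto_kappa μ hs) hr_gt).and
      (geometric.eventually (eventually_le_nhds one_pos))
  obtain ⟨n, hn_moment, hn⟩ := ((tendsto_add_atTop_nat 1).eventually eventually_le).exists
  refine ⟨q, hq_gt, n, le_trans ?_ hn⟩
  calc q ^ (n + 1) * (D * (productMoment μ s (n + 1)).toReal)
      ≤ q ^ (n + 1) * (D * r ^ (n + 1)) := by gcongr
    _ = D * (q * r) ^ (n + 1) := by rw [mul_pow]; ring

end Kappa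

section Intensity

variable {Ω : Type*} [MeasurableSpace Ω] {d : ℕ} {P : Measure Ω} {N : Ω → ℕ}
  {A : ℕ → Ω → Matrix (Fin d) (Fin d) ℝ}

lemma lintegral_sum_range (hN : Measurable N) {f : ℕ → Ω → ℝ≥0∞} (hf : ∀ i, Measurable (f i)) :
    ∫⁻ ω, ∑ i ∈ Finset.range (N ω), f i ω ∂P = ∑' i, ∫⁻ ω in {ω | i < N ω}, f i ω ∂P := by
  have measurableSet_lt_N (i : ℕ) : MeasurableSet {ω | i < N ω} :=
    measurableSet_lt measurable_const hN
  have sum_eq_tsum (ω : Ω) :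
      ∑ i ∈ Finset.range (N ω), f i ω = ∑' i, {ω | i < N ω}.indicator (f i) ω := by
    rw [tsum_eq_sum (s := Finset.range (N ω)) fun i hi =>
      Set.indicator_of_notMem (by simpa using hi) _]
    exact Finset.sum_congr rfl fun i hi => (Set.indicator_of_mem (by simpa using hi) _).symm
  simp only [sum_eq_tsum]
  rw [lintegral_tsum fun i => ((hf i).indicator (measurableSet_lt_N i)).aemeasurable]
  exact tsum_congr fun i => lintegral_indicator (measurableSet_lt_N i) _

lemma lintegral_sum_eq_mul_lintegral_intensity (hN : Measurable N) (hA : ∀ i, Measurable (A i))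
    (hm : 0 < meanN P N) {f : Matrix (Fin d) (Fin d) ℝ → ℝ≥0∞} (hf : Measurable f) :
    ∫⁻ ω, ∑ i ∈ Finset.range (N ω), f (A i ω) ∂P =
      ENNReal.ofReal (meanN P N) * ∫⁻ a, f a ∂(intensity P N A) := by
  rw [lintegral_sum_range hN (f := fun i ω => f (A i ω)) fun i => hf.comp (hA i), intensity,
    lintegral_smul_measure, lintegral_sum_measure, smul_eq_mul, ← mul_assoc,
    ENNReal.mul_inv_cancel (ENNReal.ofReal_pos.2 hm).ne' ENNReal.ofReal_ne_top, one_mul]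
  exact tsum_congr fun i => (lintegral_map hf (hA i)).symm

lemma isProbabilityMeasure_intensity (hN : Measurable N) (hA : ∀ i, Measurable (A i))
    (hm : 0 < meanN P N) : IsProbabilityMeasure (intensity P N A) := by
  have integrable_N : Integrable (fun ω => (N ω : ℝ)) P := .of_integral_ne_zero hm.ne'
  have total_mass := lintegral_sum_eq_mul_lintegral_intensity hN hA hm (f := fun _ => 1)
    measurable_const
  have mean_eq : ENNReal.ofReal (meanN P N) = ∫⁻ ω, (N ω : ℝ≥0∞) ∂P := by
    rw [meanN, ofReal_integral_eq_lintegral_ofReal integrable_N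
      (ae_of_all _ fun ω => Nat.cast_nonneg _)]
    simp only [ENNReal.ofReal_natCast]
  simp only [Finset.sum_const, Finset.card_range, nsmul_eq_mul, mul_one, lintegral_const,
    one_mul, ← mean_eq] at total_mass
  exact ⟨((ENNReal.mul_eq_left (ENNReal.ofReal_pos.2 hm).ne' ENNReal.ofReal_ne_top).1
    total_mass.symm)⟩

lemma AlphaCondition.exists_mFun_lt_one (h : AlphaCondition P N A) :
    ∃ s, 0 < s ∧ s ∈ momentSet (intensity P N A) ∧ mFun P N A s < 1 := by
  obtain ⟨α, ⟨hα, hα_interior⟩, mFun_α, deriv_neg⟩ := h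
  have hasDerivAt := (differentiableAt_of_deriv_ne_zero deriv_neg.ne).hasDerivAt
  have slope_neg : ∀ᶠ s in 𝓝[>] α, slope (mFun P N A) α s < 0 :=
    ((hasDerivAt_iff_tendsto_slope.1 hasDerivAt).mono_left
      (nhdsWithin_mono _ fun s (hs : α < s) => hs.ne')).eventually (eventually_lt_nhds deriv_neg)
  have mem_momentSet : ∀ᶠ s in 𝓝[>] α, s ∈ momentSet (intensity P N A) :=
    nhdsWithin_le_nhds (mem_interior_iff_mem_nhds.1 hα_interior)
  obtain ⟨s, hs_slope, hs_mem, hs : α < s⟩ :=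
    (slope_neg.and (mem_momentSet.and self_mem_nhdsWithin)).exists
  refine ⟨s, hα.1.trans hs, hs_mem, ?_⟩
  rw [slope_neg_iff_of_le hs.le] at hs_slope
  exact hs_slope.trans_eq mFun_α

end Intensity

/-! ### A Lyapunov function -/

section VectorMoment

variable {d : ℕ} (μ : Measure (Matrix (Fin d) (Fin d) ℝ))

/-- `E |(M_n ⋯ M_1)ᵀ t|^s` for i.i.d. `M_1, …, M_n` with law `μ`, the counterpart of `productMoment`
along a vector. -/
def vectorMoment (s : ℝ) (n : ℕ) (t : Fin d → ℝ) : ℝ≥0∞ :=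
  ∫⁻ a, ENNReal.ofReal (l1norm (aᵀ *ᵥ t)) ^ s ∂(productLaw μ n)

lemma vectorMoment_zero (s : ℝ) (t : Fin d → ℝ) :
    vectorMoment μ s 0 t = ENNReal.ofReal (l1norm t) ^ s := by
  rw [vectorMoment, productLaw, lintegral_dirac, Matrix.transpose_one, Matrix.one_mulVec]

/-- The finite part `∑_{k < n} q^k E |(M_k ⋯ M_1)ᵀ t|^s` of a resolvent: with `q` slightly above
`E[N]` and `n` large it is a Lyapunov function for the passage from `t` to the `A_iᵀ t`. -/
def resolventSum (s : ℝ) (q : ℝ≥0∞) (n : ℕ) (t : Fin d → ℝ) : ℝ≥0∞ :=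
  ∑ k ∈ Finset.range n, q ^ k * vectorMoment μ s k t

lemma rpow_le_resolventSum_succ (s : ℝ) (q : ℝ≥0∞) (n : ℕ) (t : Fin d → ℝ) :
    ENNReal.ofReal (l1norm t) ^ s ≤ resolventSum μ s q (n + 1) t :=
  calc ENNReal.ofReal (l1norm t) ^ s = q ^ 0 * vectorMoment μ s 0 t := by
        rw [vectorMoment_zero, pow_zero, one_mul]
    _ ≤ resolventSum μ s q (n + 1) t :=
        Finset.single_le_sum (f := fun k => q ^ k * vectorMoment μ s k t) (fun _ _ => zero_le)
          (Finset.mem_range.2 n.succ_pos)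

variable [IsProbabilityMeasure μ]

lemma vectorMoment_succ (s : ℝ) (n : ℕ) (t : Fin d → ℝ) :
    vectorMoment μ s (n + 1) t = ∫⁻ a, vectorMoment μ s n (aᵀ *ᵥ t) ∂μ := by
  have measurable_integrand : Measurable fun a : Matrix (Fin d) (Fin d) ℝ =>
      ENNReal.ofReal (l1norm (aᵀ *ᵥ t)) ^ s :=
    (measurable_l1norm_rpow s).comp (measurable_transpose_mulVec_const t)
  rw [vectorMoment, productLaw, Measure.lintegral_mconv measurable_integrand]
  simp only [vectorMoment, Matrix.transpose_mul, Matrix.mulVec_mulVec]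

lemma measurable_vectorMoment (s : ℝ) (n : ℕ) : Measurable (vectorMoment μ s n) :=
  Measurable.lintegral_prod_right' (f := fun p : (Fin d → ℝ) × Matrix (Fin d) (Fin d) ℝ =>
    ENNReal.ofReal (l1norm (p.2ᵀ *ᵥ p.1)) ^ s)
    ((measurable_l1norm_rpow s).comp (measurable_transpose_mulVec.comp measurable_swap))

lemma vectorMoment_le {s : ℝ} (hs : 0 ≤ s) (n : ℕ) (t : Fin d → ℝ) :
    vectorMoment μ s n t ≤
      (d : ℝ≥0∞) ^ s * productMoment μ s n * ENNReal.ofReal (l1norm t) ^ s := by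
  rw [vectorMoment, productMoment_eq_lintegral_productLaw,
    ← lintegral_const_mul _ (measurable_opNorm_rpow s),
    ← lintegral_mul_const _ ((measurable_opNorm_rpow s).const_mul _)]
  refine lintegral_mono fun a => ?_
  rw [← ENNReal.mul_rpow_of_nonneg _ _ hs, ← ENNReal.mul_rpow_of_nonneg _ _ hs,
    ← ENNReal.ofReal_natCast, ← ENNReal.ofReal_mul (by positivity),
    ← ENNReal.ofReal_mul (mul_nonneg (by positivity) (opNorm_nonneg _))]
  exact ENNReal.rpow_le_rpow (ENNReal.ofReal_le_ofReal (l1norm_transpose_mulVec_le _ _)) hs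

lemma measurable_resolventSum (s : ℝ) (q : ℝ≥0∞) (n : ℕ) : Measurable (resolventSum μ s q n) :=
  Finset.measurable_sum _ fun k _ => (measurable_vectorMoment μ s k).const_mul _

lemma exists_resolventSum_le {s : ℝ} (hs : s ∈ momentSet μ) (q : ℝ) (n : ℕ) :
    ∃ K : ℝ, ∀ t, resolventSum μ s (ENNReal.ofReal q) n t ≤
      ENNReal.ofReal (K * l1norm t ^ s) := by
  set K : ℝ≥0∞ := ∑ k ∈ Finset.range n,
    ENNReal.ofReal q ^ k * ((d : ℝ≥0∞) ^ s * productMoment μ s k)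
  have K_ne_top : K ≠ ∞ := ENNReal.sum_ne_top.2 fun k _ =>
    ENNReal.mul_ne_top (ENNReal.pow_ne_top ENNReal.ofReal_ne_top)
      (ENNReal.mul_ne_top (ENNReal.rpow_ne_top_of_nonneg hs.1 (ENNReal.natCast_ne_top d))
        (productMoment_ne_top μ hs k))
  refine ⟨K.toReal, fun t => ?_⟩
  rw [ENNReal.ofReal_mul ENNReal.toReal_nonneg, ENNReal.ofReal_toReal K_ne_top,
    ← ENNReal.ofReal_rpow_of_nonneg (l1norm_nonneg t) hs.1, resolventSum, Finset.sum_mul]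
  refine Finset.sum_le_sum fun k _ => ?_
  rw [mul_assoc]
  gcongr
  exact vectorMoment_le μ hs.1 k t

lemma mul_lintegral_resolventSum_add (s : ℝ) (q : ℝ≥0∞) (n : ℕ) (t : Fin d → ℝ) :
    q * ∫⁻ a, resolventSum μ s q n (aᵀ *ᵥ t) ∂μ + ENNReal.ofReal (l1norm t) ^ s =
      resolventSum μ s q n t + q ^ n * vectorMoment μ s n t := by
  have measurable_term (k : ℕ) :
      Measurable fun a : Matrix (Fin d) (Fin d) ℝ => vectorMoment μ s k (aᵀ *ᵥ t) :=
    (measurable_vectorMoment μ s k).comp (measurable_transpose_mulVec_const t)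
  have integral_eq : ∫⁻ a, resolventSum μ s q n (aᵀ *ᵥ t) ∂μ =
      ∑ k ∈ Finset.range n, q ^ k * vectorMoment μ s (k + 1) t := by
    simp only [resolventSum]
    rw [lintegral_finsetSum _ fun k _ => (measurable_term k).const_mul _]
    exact Finset.sum_congr rfl fun k _ => by
      rw [lintegral_const_mul _ (measurable_term k), vectorMoment_succ]
  calc q * ∫⁻ a, resolventSum μ s q n (aᵀ *ᵥ t) ∂μ + ENNReal.ofReal (l1norm t) ^ s
      = ∑ k ∈ Finset.range n, q ^ (k + 1) * vectorMoment μ s (k + 1) t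
          + q ^ 0 * vectorMoment μ s 0 t := by
        rw [integral_eq, Finset.mul_sum, vectorMoment_zero, pow_zero, one_mul]
        simp only [pow_succ', mul_assoc]
    _ = resolventSum μ s q n t + q ^ n * vectorMoment μ s n t := by
        rw [← Finset.sum_range_succ' fun k => q ^ k * vectorMoment μ s k t,
          Finset.sum_range_succ, resolventSum]

lemma mul_lintegral_resolventSum_le {s : ℝ} (hs : 0 ≤ s) {q : ℝ≥0∞} {n : ℕ}
    (hq : q ^ n * ((d : ℝ≥0∞) ^ s * productMoment μ s n) ≤ 1) (t : Fin d → ℝ) :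
    q * ∫⁻ a, resolventSum μ s q n (aᵀ *ᵥ t) ∂μ ≤ resolventSum μ s q n t := by
  have rpow_ne_top : ENNReal.ofReal (l1norm t) ^ s ≠ ∞ :=
    ENNReal.rpow_ne_top_of_nonneg hs ENNReal.ofReal_ne_top
  refine (ENNReal.add_le_add_iff_right rpow_ne_top).1 ?_
  rw [mul_lintegral_resolventSum_add]
  gcongr
  calc q ^ n * vectorMoment μ s n t
      ≤ q ^ n * ((d : ℝ≥0∞) ^ s * productMoment μ s n * ENNReal.ofReal (l1norm t) ^ s) := by
        gcongr
        exact vectorMoment_le μ hs n t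
    _ ≤ 1 * ENNReal.ofReal (l1norm t) ^ s := by
        rw [← mul_assoc]
        gcongr
    _ = ENNReal.ofReal (l1norm t) ^ s := one_mul _

end VectorMoment

section Lyapunov

variable {Ω : Type*} [MeasurableSpace Ω] {d : ℕ}

/-- `w` is comparable to `|t|^s`, and its expected total over the `A_iᵀ t` contracts by the factor
`ρ`. This is the quantitative content of the existence of an `s` with `m(s) < 1`. -/
structure IsLyapunov (P : Measure Ω) (N : Ω → ℕ) (A : ℕ → Ω → Matrix (Fin d) (Fin d) ℝ)
    (s ρ K : ℝ) (w : (Fin d → ℝ) → ℝ) : Prop where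
  exponent_pos : 0 < s
  rate_pos : 0 < ρ
  rate_lt_one : ρ < 1
  measurable : Measurable w
  rpow_le : ∀ t, l1norm t ^ s ≤ w t
  le_mul_rpow : ∀ t, w t ≤ K * l1norm t ^ s
  lintegral_sum_le : ∀ t, ∫⁻ ω, ∑ i ∈ Finset.range (N ω), ENNReal.ofReal (w ((A i ω)ᵀ *ᵥ t)) ∂P ≤
    ENNReal.ofReal (ρ * w t)

variable {P : Measure Ω} {N : Ω → ℕ} {A : ℕ → Ω → Matrix (Fin d) (Fin d) ℝ}

lemma exists_isLyapunov_resolventSum (hN : Measurable N) (hA : ∀ i, Measurable (A i))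
    (hm : 0 < meanN P N) {s : ℝ} (hs_pos : 0 < s) (hs : s ∈ momentSet (intensity P N A))
    {q : ℝ} (hq_gt : meanN P N < q) {n : ℕ}
    (hq : ENNReal.ofReal q ^ (n + 1) *
      ((d : ℝ≥0∞) ^ s * productMoment (intensity P N A) s (n + 1)) ≤ 1) :
    ∃ K, IsLyapunov P N A s (meanN P N / q) K fun t =>
      (resolventSum (intensity P N A) s (ENNReal.ofReal q) (n + 1) t).toReal := by
  have := isProbabilityMeasure_intensity hN hA hm
  set m := meanN P N
  have hq_pos : 0 < q := hm.trans hq_gt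
  obtain ⟨K, hK⟩ := exists_resolventSum_le (intensity P N A) hs q (n + 1)
  set W := resolventSum (intensity P N A) s (ENNReal.ofReal q) (n + 1)
  have W_ne_top (t : Fin d → ℝ) : W t ≠ ∞ := ne_top_of_le_ne_top ENNReal.ofReal_ne_top (hK t)
  have measurable_W : Measurable W := measurable_resolventSum (intensity P N A) s _ _
  have rpow_le (t : Fin d → ℝ) : l1norm t ^ s ≤ (W t).toReal := by
    rw [← ENNReal.ofReal_le_iff_le_toReal (W_ne_top t),
      ← ENNReal.ofReal_rpow_of_nonneg (l1norm_nonneg t) hs_pos.le]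
    exact rpow_le_resolventSum_succ _ s _ n t
  refine ⟨max K 0, hs_pos, by positivity, (div_lt_one hq_pos).2 hq_gt,
    measurable_W.ennreal_toReal, rpow_le, fun t => ?_, fun t => ?_⟩
  · have rpow_nonneg : 0 ≤ l1norm t ^ s := Real.rpow_nonneg (l1norm_nonneg t) s
    refine ENNReal.toReal_le_of_le_ofReal (by positivity) ((hK t).trans ?_)
    gcongr
    exact le_max_left K 0
  · simp only [ENNReal.ofReal_toReal (W_ne_top _)]
    calc ∫⁻ ω, ∑ i ∈ Finset.range (N ω), W ((A i ω)ᵀ *ᵥ t) ∂P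
        = ENNReal.ofReal m * ∫⁻ a, W (aᵀ *ᵥ t) ∂(intensity P N A) :=
          lintegral_sum_eq_mul_lintegral_intensity hN hA hm
            (f := fun a => W (aᵀ *ᵥ t)) (measurable_W.comp (measurable_transpose_mulVec_const t))
      _ = ENNReal.ofReal (m / q) *
            (ENNReal.ofReal q * ∫⁻ a, W (aᵀ *ᵥ t) ∂(intensity P N A)) := by
          rw [← mul_assoc, ← ENNReal.ofReal_mul (by positivity), div_mul_cancel₀ _ hq_pos.ne']
      _ ≤ ENNReal.ofReal (m / q) * W t := by
          gcongr
          exact mul_lintegral_resolventSum_le _ hs_pos.le hq t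
      _ = ENNReal.ofReal (m / q * (W t).toReal) := by
          rw [ENNReal.ofReal_mul (by positivity), ENNReal.ofReal_toReal (W_ne_top t)]

lemma exists_isLyapunov (hN : Measurable N) (hA : ∀ i, Measurable (A i)) (hm : 0 < meanN P N)
    {s : ℝ} (hs_pos : 0 < s) (hs : s ∈ momentSet (intensity P N A)) (hlt : mFun P N A s < 1) :
    ∃ ρ K w, IsLyapunov P N A s ρ K w := by
  have := isProbabilityMeasure_intensity hN hA hm
  obtain ⟨q, hq_gt, n, hq⟩ :=
    exists_pow_mul_productMoment_le_one _ hs hm hlt (D := (d : ℝ) ^ s) (by positivity)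
  have hq_pos : 0 < q := hm.trans hq_gt
  refine ⟨_, (exists_isLyapunov_resolventSum hN hA hm hs_pos hs hq_gt (n := n) ?_).imp
    fun K hK => ⟨_, hK⟩⟩
  rw [← ENNReal.ofReal_toReal (productMoment_ne_top _ hs (n + 1)), ← ENNReal.ofReal_natCast,
    ENNReal.ofReal_rpow_of_nonneg (by positivity) hs_pos.le, ← ENNReal.ofReal_mul (by positivity),
    ← ENNReal.ofReal_pow hq_pos.le, ← ENNReal.ofReal_mul (by positivity)]
  exact ENNReal.ofReal_le_one.2 hq

end Lyapunov

/-! ### Sums of independent linear images -/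

section SumLaw

open Measure

variable {V E F : Type*}
  [NormedAddCommGroup V] [NormedSpace ℝ V] [MeasurableSpace V] [BorelSpace V]
  [NormedAddCommGroup E] [NormedSpace ℝ E] [MeasurableSpace E] [BorelSpace E]
  [SecondCountableTopology E]
  [NormedAddCommGroup F] [NormedSpace ℝ F] [MeasurableSpace F] [BorelSpace F]
  [SecondCountableTopology F]

/-- The law of `C_1 Z_1 + ⋯ + C_k Z_k` for i.i.d. `Z_i` with law `η` and a list `C_1, …, C_k` of
continuous linear maps. -/
def sumLaw {V E : Type*} [NormedAddCommGroup V] [NormedSpace ℝ V] [MeasurableSpace V]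
    [NormedAddCommGroup E] [NormedSpace ℝ E] [MeasurableSpace E] (η : Measure V) :
    List (V →L[ℝ] E) → Measure E
  | [] => dirac 0
  | C :: l => η.map C ∗ sumLaw η l

omit [BorelSpace V] in
lemma sumLaw_singleton (η : Measure V) [SFinite η] (C : V →L[ℝ] E) : sumLaw η [C] = η.map C := by
  rw [sumLaw, sumLaw, conv_dirac_zero]

variable (η : Measure V) [IsProbabilityMeasure η]

instance instIsProbabilityMeasureMapCLM (C : V →L[ℝ] E) : IsProbabilityMeasure (η.map C) :=
  isProbabilityMeasure_map C.continuous.aemeasurable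

instance instIsProbabilityMeasureSumLaw (l : List (V →L[ℝ] E)) :
    IsProbabilityMeasure (sumLaw η l) := by
  induction l with
  | nil => exact dirac.isProbabilityMeasure
  | cons C l ih => exact probabilitymeasure_of_probabilitymeasures_conv _ _

lemma sumLaw_append (l l' : List (V →L[ℝ] E)) :
    sumLaw η (l ++ l') = sumLaw η l ∗ sumLaw η l' := by
  induction l with
  | nil => rw [List.nil_append, sumLaw, dirac_zero_conv]
  | cons C l ih => rw [List.cons_append, sumLaw, sumLaw, ih, conv_assoc]

lemma sumLaw_perm {l l' : List (V →L[ℝ] E)} (h : l.Perm l') : sumLaw η l = sumLaw η l' := by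
  induction h with
  | nil => rfl
  | cons C _ ih => rw [sumLaw, sumLaw, ih]
  | swap C C' l =>
    rw [sumLaw, sumLaw, sumLaw, sumLaw, ← conv_assoc, ← conv_assoc, conv_comm (η.map C')]
  | trans _ _ ih ih' => exact ih.trans ih'

lemma sumLaw_zero_cons (l : List (V →L[ℝ] E)) : sumLaw η (0 :: l) = sumLaw η l := by
  have map_zero : η.map (0 : V →L[ℝ] E) = dirac 0 :=
    (Measure.map_const η 0).trans (by rw [measure_univ, one_smul])
  rw [sumLaw, map_zero, dirac_zero_conv]

open scoped Classical in
lemma sumLaw_filter_ne_zero (l : List (V →L[ℝ] E)) :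
    sumLaw η (l.filter (· ≠ 0)) = sumLaw η l := by
  induction l with
  | nil => rfl
  | cons C l ih =>
    obtain rfl | hC := eq_or_ne C 0
    · rw [sumLaw_zero_cons, ← ih, List.filter_cons_of_neg (by simp)]
    · rw [List.filter_cons_of_pos (by simpa using hC), sumLaw, sumLaw, ih]

lemma map_sumLaw (D : E →L[ℝ] F) (l : List (V →L[ℝ] E)) :
    (sumLaw η l).map D = sumLaw η (l.map D.comp) := by
  induction l with
  | nil => exact (map_dirac' D.continuous.measurable _).trans (by rw [map_zero]; rfl)
  | cons C l ih =>
    rw [sumLaw, map_conv_continuousLinearMap, ih, List.map_cons, sumLaw,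
      Measure.map_map D.continuous.measurable C.continuous.measurable]
    rfl

lemma charFunDual_sumLaw (l : List (V →L[ℝ] E)) (L : StrongDual ℝ E) :
    charFunDual (sumLaw η l) L = (l.map fun C => charFunDual η (L.comp C)).prod := by
  induction l with
  | nil => simp [sumLaw, charFunDual_dirac]
  | cons C l ih =>
    rw [sumLaw, charFunDual_conv, ih, charFunDual_map, List.map_cons, List.prod_cons]

lemma map_sum_infinitePi (C : ℕ → V →L[ℝ] E) (n : ℕ) :
    (infinitePi fun _ : ℕ => η).map (fun z => ∑ i ∈ Finset.range n, C i (z i)) =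
      sumLaw η ((List.range n).map C) := by
  induction n with
  | zero => simp [sumLaw, Measure.map_const]
  | succ n ih =>
    have measurable_term (i : ℕ) : Measurable fun z : ℕ → V => C i (z i) :=
      (C i).continuous.measurable.comp (measurable_pi_apply i)
    have indep_terms : iIndepFun (fun i (z : ℕ → V) => C i (z i)) (infinitePi fun _ => η) :=
      iIndepFun_infinitePi (X := fun i x => C i x) fun i => (C i).continuous.measurable
    have indep_last : IndepFun (fun z => ∑ i ∈ Finset.range n, C i (z i)) (fun z => C n (z n))
        (infinitePi fun _ : ℕ => η) := by
      simpa only [Finset.sum_fn] using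
        indep_terms.indepFun_finsetSum_of_notMem measurable_term Finset.notMem_range_self
    have law_last : (infinitePi fun _ : ℕ => η).map (fun z => C n (z n)) = sumLaw η [C n] := by
      rw [← Function.comp_def (C n) fun z : ℕ → V => z n,
        ← Measure.map_map (C n).continuous.measurable (measurable_pi_apply n),
        infinitePi_map_eval, sumLaw_singleton]
    simp only [Finset.sum_range_succ, List.range_succ, List.map_append, List.map_singleton]
    rw [sumLaw_append, ← ih, ← law_last]
    exact indep_last.map_add_eq_map_conv_map
      (Finset.measurable_sum _ fun i _ => measurable_term i) (measurable_term n)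

end SumLaw

/-! ### Characteristic functions and the fixed point equation -/

section CharFun

variable {d : ℕ}

/-- The linear form `x ↦ ⟨t, x⟩`. -/
def dotCLM (t : Fin d → ℝ) : StrongDual ℝ (Fin d → ℝ) :=
  LinearMap.toContinuousLinearMap (dotProductBilin ℝ ℝ t)

lemma dotCLM_apply (t x : Fin d → ℝ) : dotCLM t x = t ⬝ᵥ x := rfl

/-- The continuous linear map `x ↦ a x`. -/
def matCLM (a : Matrix (Fin d) (Fin d) ℝ) : (Fin d → ℝ) →L[ℝ] (Fin d → ℝ) :=
  LinearMap.toContinuousLinearMap a.mulVecLin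

lemma matCLM_apply (a : Matrix (Fin d) (Fin d) ℝ) (x : Fin d → ℝ) : matCLM a x = a *ᵥ x := rfl

lemma dotCLM_comp_matCLM (t : Fin d → ℝ) (a : Matrix (Fin d) (Fin d) ℝ) :
    (dotCLM t).comp (matCLM a) = dotCLM (aᵀ *ᵥ t) := by
  ext1 x
  rw [ContinuousLinearMap.comp_apply, dotCLM_apply, matCLM_apply, dotCLM_apply,
    Matrix.dotProduct_mulVec, Matrix.mulVec_transpose]

/-- The characteristic function `t ↦ E e^{i⟨t, Z⟩}` of a law on `ℝ^d`, where `ℝ^d` is identified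
with its dual by the dot product rather than by an inner product structure. -/
def chf (η : Measure (Fin d → ℝ)) (t : Fin d → ℝ) : ℂ := charFunDual η (dotCLM t)

lemma chf_apply (η : Measure (Fin d → ℝ)) (t : Fin d → ℝ) :
    chf η t = ∫ x, Complex.exp (((t ⬝ᵥ x : ℝ) : ℂ) * Complex.I) ∂η :=
  charFunDual_apply _

lemma chf_map {Ω : Type*} [MeasurableSpace Ω] {Q : Measure Ω} {Z : Ω → Fin d → ℝ}
    (hZ : AEMeasurable Z Q) (t : Fin d → ℝ) :
    chf (Q.map Z) t = ∫ ω, Complex.exp (Complex.I * ((t ⬝ᵥ Z ω : ℝ) : ℂ)) ∂Q := by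
  rw [chf_apply, integral_map hZ (Continuous.aestronglyMeasurable (by fun_prop))]
  simp only [mul_comm]

variable (η : Measure (Fin d → ℝ)) [IsProbabilityMeasure η]

lemma norm_chf_le_one (t : Fin d → ℝ) : ‖chf η t‖ ≤ 1 := by
  rw [chf, charFunDual_eq_charFun_map_one]
  exact norm_charFun_le_one _

lemma continuous_chf : Continuous (chf η) := by
  simp only [funext (chf_apply η)]
  refine continuous_of_dominated (bound := fun _ => 1) (fun t => ?_) (fun t => ?_)
    (integrable_const _) ?_
  · exact Continuous.aestronglyMeasurable (by fun_prop)
  · exact ae_of_all _ fun x => (Complex.norm_exp_ofReal_mul_I _).le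
  · exact ae_of_all _ fun x => by fun_prop

end CharFun

section FixedPoint

variable {Ω : Type*} {d : ℕ} {N : Ω → ℕ} {A : ℕ → Ω → Matrix (Fin d) (Fin d) ℝ}
  {η : Measure (Fin d → ℝ)}

/-- The maps `x ↦ A_i x` for `i < N`, whose `sumLaw` is the conditional law of `∑ A_i Z_i` given
`(N, A_1, A_2, …)`. -/
def childMaps (N : Ω → ℕ) (A : ℕ → Ω → Matrix (Fin d) (Fin d) ℝ) (ω : Ω) :
    List ((Fin d → ℝ) →L[ℝ] (Fin d → ℝ)) :=
  (List.range (N ω)).map fun i => matCLM (A i ω)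

lemma map_smoothing_sum (η : Measure (Fin d → ℝ)) [IsProbabilityMeasure η] (ω : Ω) :
    (Measure.infinitePi fun _ : ℕ => η).map
        (fun z => ∑ i ∈ Finset.range (N ω), A i ω *ᵥ z i) = sumLaw η (childMaps N A ω) :=
  map_sum_infinitePi η (fun i => matCLM (A i ω)) (N ω)

lemma chf_sumLaw_childMaps [IsProbabilityMeasure η] (ω : Ω) (t : Fin d → ℝ) :
    chf (sumLaw η (childMaps N A ω)) t =
      ∏ i ∈ Finset.range (N ω), chf η ((A i ω)ᵀ *ᵥ t) := by
  simp only [chf, charFunDual_sumLaw, childMaps, List.map_map, Function.comp_def,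
    dotCLM_comp_matCLM]
  exact (Multiset.prod_coe _).symm

variable [MeasurableSpace Ω] {P : Measure Ω}

lemma measurable_smoothing_sum (hN : Measurable N) (hA : ∀ i, Measurable (A i)) :
    Measurable fun p : Ω × (ℕ → Fin d → ℝ) => ∑ i ∈ Finset.range (N p.1), A i p.1 *ᵥ p.2 i := by
  have measurable_mulVec : Measurable fun p : Matrix (Fin d) (Fin d) ℝ × (Fin d → ℝ) =>
      p.1 *ᵥ p.2 := (continuous_fst.matrix_mulVec continuous_snd).measurable
  have measurable_term (i : ℕ) : Measurable fun p : Ω × (ℕ → Fin d → ℝ) => A i p.1 *ᵥ p.2 i :=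
    measurable_mulVec.comp
      (((hA i).comp measurable_fst).prodMk ((measurable_pi_apply i).comp measurable_snd))
  have measurable_sum : Measurable fun q : ℕ × (Ω × (ℕ → Fin d → ℝ)) =>
      ∑ i ∈ Finset.range q.1, A i q.2.1 *ᵥ q.2.2 i :=
    measurable_from_prod_countable_right fun n =>
      Finset.measurable_sum (Finset.range n) fun i _ => measurable_term i
  exact measurable_sum.comp ((hN.comp measurable_fst).prodMk measurable_id)

variable [IsProbabilityMeasure η]

lemma lintegral_eq_of_fixed (hN : Measurable N) (hA : ∀ i, Measurable (A i))
    (hη : smoothingTransform P N A η = η) {g : (Fin d → ℝ) → ℝ≥0∞} (hg : Measurable g) :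
    ∫⁻ x, g x ∂η = ∫⁻ ω, ∫⁻ x, g x ∂(sumLaw η (childMaps N A ω)) ∂P := by
  have measurable_sum := measurable_smoothing_sum hN hA
  conv_lhs => rw [← hη]
  rw [smoothingTransform, lintegral_map hg measurable_sum,
    lintegral_prod _ (by exact (hg.comp measurable_sum).aemeasurable)]
  refine lintegral_congr fun ω => ?_
  rw [← map_smoothing_sum η ω,
    lintegral_map hg (by exact measurable_sum.comp measurable_prodMk_left)]

lemma chf_eq_of_fixed [IsFiniteMeasure P] (hN : Measurable N) (hA : ∀ i, Measurable (A i))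
    (hη : smoothingTransform P N A η = η) (t : Fin d → ℝ) :
    chf η t = ∫ ω, ∏ i ∈ Finset.range (N ω), chf η ((A i ω)ᵀ *ᵥ t) ∂P := by
  have measurable_sum := measurable_smoothing_sum hN hA
  have continuous_exp :
      Continuous fun x : Fin d → ℝ => Complex.exp (((t ⬝ᵥ x : ℝ) : ℂ) * Complex.I) := by
    fun_prop
  have integrable_exp : Integrable (fun p : Ω × (ℕ → Fin d → ℝ) => Complex.exp
      (((t ⬝ᵥ ∑ i ∈ Finset.range (N p.1), A i p.1 *ᵥ p.2 i : ℝ) : ℂ) * Complex.I))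
      (P.prod (Measure.infinitePi fun _ : ℕ => η)) :=
    (integrable_const (1 : ℝ)).mono'
      (continuous_exp.measurable.comp measurable_sum).aestronglyMeasurable
      (ae_of_all _ fun p => (Complex.norm_exp_ofReal_mul_I _).le)
  rw [chf_apply]
  conv_lhs => rw [← hη]
  rw [smoothingTransform, integral_map measurable_sum.aemeasurable
    continuous_exp.aestronglyMeasurable, integral_prod _ integrable_exp]
  refine integral_congr_ae (ae_of_all _ fun ω => ?_)
  beta_reduce
  rw [← chf_sumLaw_childMaps, chf_apply, ← map_smoothing_sum η ω, integral_map
    (by exact (measurable_sum.comp measurable_prodMk_left).aemeasurable)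
    continuous_exp.aestronglyMeasurable]

lemma norm_chf_le_integral_prod [IsFiniteMeasure P] (hN : Measurable N)
    (hA : ∀ i, Measurable (A i)) (hη : smoothingTransform P N A η = η) (t : Fin d → ℝ) :
    ‖chf η t‖ ≤ ∫ ω, ∏ i ∈ Finset.range (N ω), ‖chf η ((A i ω)ᵀ *ᵥ t)‖ ∂P := by
  rw [chf_eq_of_fixed hN hA hη t]
  exact (norm_integral_le_integral_norm _).trans_eq (by simp only [norm_prod])

end FixedPoint

/-! ### Following one child, and two large children -/

section Children

variable {Ω : Type*} {d : ℕ} {N : Ω → ℕ} {A : ℕ → Ω → Matrix (Fin d) (Fin d) ℝ}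

lemma lt_of_transpose_mulVec_ne_zero {ω : Ω} (hzero : ∀ i, N ω ≤ i → A i ω = 0) {i : ℕ}
    {t : Fin d → ℝ} (h : (A i ω)ᵀ *ᵥ t ≠ 0) : i < N ω := by
  contrapose! h
  rw [hzero i h, Matrix.transpose_zero, Matrix.zero_mulVec]

variable [MeasurableSpace Ω] {P : Measure Ω}

/-- A random vector `T`, standing for `A_jᵀ t` with a random index `j`, along which `h` does not
decrease in mean, the Lyapunov function `w` contracts in mean, and a negative moment of the norm is
controlled. -/
structure ChildStep (P : Measure Ω) (h w : (Fin d → ℝ) → ℝ) (ρ ε C : ℝ) (t : Fin d → ℝ)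
    (T : Ω → Fin d → ℝ) : Prop where
  measurable : Measurable T
  ne_zero : ∀ᵐ ω ∂P, T ω ≠ 0
  integrable_lyapunov : Integrable (fun ω => w (T ω)) P
  integral_lyapunov_le : ∫ ω, w (T ω) ∂P ≤ ρ * w t
  integrable_rpow : Integrable (fun ω => l1norm (T ω) ^ (-ε)) P
  integral_rpow_le : ∫ ω, l1norm (T ω) ^ (-ε) ∂P ≤ C * l1norm t ^ (-ε)
  le_integral : h t ≤ ∫ ω, h (T ω) ∂P

lemma integrable_and_integral_le_of_lintegral_le {f : Ω → ℝ} (hf : AEStronglyMeasurable f P)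
    (f_nonneg : 0 ≤ᵐ[P] f) {c : ℝ} (hc : 0 ≤ c)
    (hle : ∫⁻ ω, ENNReal.ofReal (f ω) ∂P ≤ ENNReal.ofReal c) :
    Integrable f P ∧ ∫ ω, f ω ∂P ≤ c := by
  refine ⟨⟨hf, (hasFiniteIntegral_iff_ofReal f_nonneg).2 (hle.trans_lt ENNReal.ofReal_lt_top)⟩, ?_⟩
  rw [integral_eq_lintegral_of_nonneg_ae f_nonneg hf]
  exact ENNReal.toReal_le_of_le_ofReal hc hle

lemma measurable_transpose_mulVec_select (hA : ∀ i, Measurable (A i)) {j : Ω → ℕ}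
    (hj : Measurable j) (t : Fin d → ℝ) : Measurable fun ω => (A (j ω) ω)ᵀ *ᵥ t := by
  have measurable_A : Measurable fun q : ℕ × Ω => A q.1 q.2 :=
    measurable_from_prod_countable_right hA
  exact (measurable_transpose_mulVec_const t).comp (measurable_A.comp (hj.prodMk measurable_id))

lemma transpose_mulVec_eq_smul_normalize (a : Matrix (Fin d) (Fin d) ℝ) {t : Fin d → ℝ}
    (ht : t ≠ 0) : aᵀ *ᵥ t = l1norm t • aᵀ *ᵥ ((l1norm t)⁻¹ • t) := by
  rw [Matrix.mulVec_smul, smul_smul, mul_inv_cancel₀ (l1norm_pos ht).ne', one_smul]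

lemma ActivityCondition.exists_index_integral_rpow_neg_le (hA : ∀ i, Measurable (A i))
    (h_active : ActivityCondition P A) :
    ∃ ε C : ℝ, 0 < ε ∧ 0 < C ∧ ∀ t ≠ 0, ∃ j : Ω → ℕ, Measurable j ∧
      (∀ᵐ ω ∂P, (A (j ω) ω)ᵀ *ᵥ t ≠ 0) ∧
      Integrable (fun ω => l1norm ((A (j ω) ω)ᵀ *ᵥ t) ^ (-ε)) P ∧
      ∫ ω, l1norm ((A (j ω) ω)ᵀ *ᵥ t) ^ (-ε) ∂P ≤ C * l1norm t ^ (-ε) := by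
  obtain ⟨ε, hε, i, hi, hsup⟩ := h_active.harmonic
  set S := ⨆ t ∈ {t : Fin d → ℝ | l1norm t = 1},
      ∫⁻ ω, ENNReal.ofReal (l1norm ((A (i t ω) ω)ᵀ *ᵥ t)) ^ (-ε) ∂P
  refine ⟨ε, S.toReal + 1, hε, by positivity, fun t ht => ?_⟩
  have t_pos := l1norm_pos ht
  set u := (l1norm t)⁻¹ • t
  have hu : l1norm u = 1 := l1norm_normalize ht
  obtain ⟨measurable_index, ne_zero_u⟩ := hi u hu
  refine ⟨i u, measurable_index, ?_, integrable_and_integral_le_of_lintegral_le ?_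
    (ae_of_all _ fun ω => Real.rpow_nonneg (l1norm_nonneg _) _) (by positivity) ?_⟩
  · filter_upwards [ne_zero_u] with ω hω
    rw [transpose_mulVec_eq_smul_normalize _ ht]
    exact smul_ne_zero t_pos.ne' hω
  · exact ((continuous_l1norm.measurable.comp
      (measurable_transpose_mulVec_select hA measurable_index t)).pow_const _).aestronglyMeasurable
  · have homogeneity : ∀ᵐ ω ∂P, ENNReal.ofReal (l1norm ((A (i u ω) ω)ᵀ *ᵥ t) ^ (-ε)) =
        ENNReal.ofReal (l1norm t ^ (-ε)) *
          ENNReal.ofReal (l1norm ((A (i u ω) ω)ᵀ *ᵥ u)) ^ (-ε) := by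
      filter_upwards [ne_zero_u] with ω hω
      rw [ENNReal.ofReal_rpow_of_pos (l1norm_pos hω), ← ENNReal.ofReal_mul (by positivity),
        transpose_mulVec_eq_smul_normalize _ ht, l1norm_smul, abs_of_pos t_pos,
        Real.mul_rpow t_pos.le (l1norm_nonneg _)]
    rw [lintegral_congr_ae homogeneity, lintegral_const_mul' _ _ ENNReal.ofReal_ne_top, mul_comm,
      ENNReal.ofReal_mul (by positivity)]
    gcongr
    calc ∫⁻ ω, ENNReal.ofReal (l1norm ((A (i u ω) ω)ᵀ *ᵥ u)) ^ (-ε) ∂P ≤ S :=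
          le_iSup₂ (f := fun (t : Fin d → ℝ) (_ : t ∈ {t : Fin d → ℝ | l1norm t = 1}) =>
            ∫⁻ ω, ENNReal.ofReal (l1norm ((A (i t ω) ω)ᵀ *ᵥ t)) ^ (-ε) ∂P) u hu
      _ = ENNReal.ofReal S.toReal := (ENNReal.ofReal_toReal hsup.ne).symm
      _ ≤ ENNReal.ofReal (S.toReal + 1) := ENNReal.ofReal_le_ofReal (by linarith)

lemma IsLyapunov.nonneg {s ρ K : ℝ} {w : (Fin d → ℝ) → ℝ} (hw : IsLyapunov P N A s ρ K w)
    (t : Fin d → ℝ) : 0 ≤ w t :=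
  (Real.rpow_nonneg (l1norm_nonneg t) s).trans (hw.rpow_le t)

lemma IsLyapunov.integrable_and_integral_select_le {s ρ K : ℝ} {w : (Fin d → ℝ) → ℝ}
    (hw : IsLyapunov P N A s ρ K w) (hA : ∀ i, Measurable (A i)) {j : Ω → ℕ} (hj : Measurable j)
    (hj_lt : ∀ᵐ ω ∂P, j ω < N ω) (t : Fin d → ℝ) :
    Integrable (fun ω => w ((A (j ω) ω)ᵀ *ᵥ t)) P ∧
      ∫ ω, w ((A (j ω) ω)ᵀ *ᵥ t) ∂P ≤ ρ * w t := by
  refine integrable_and_integral_le_of_lintegral_le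
    (hw.measurable.comp (measurable_transpose_mulVec_select hA hj t)).aestronglyMeasurable
    (ae_of_all _ fun ω => hw.nonneg _) (mul_nonneg hw.rate_pos.le (hw.nonneg t))
    (le_trans (lintegral_mono_ae ?_) (hw.lintegral_sum_le t))
  filter_upwards [hj_lt] with ω hω
  exact Finset.single_le_sum (f := fun k => ENNReal.ofReal (w ((A k ω)ᵀ *ᵥ t)))
    (fun _ _ => zero_le) (Finset.mem_range.2 hω)

variable {η : Measure (Fin d → ℝ)} [IsProbabilityMeasure η] [IsFiniteMeasure P]

lemma norm_chf_le_integral_select (hN : Measurable N) (hA : ∀ i, Measurable (A i))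
    (hη : smoothingTransform P N A η = η) {j : Ω → ℕ} (hj : Measurable j)
    (hj_lt : ∀ᵐ ω ∂P, j ω < N ω) (t : Fin d → ℝ) :
    ‖chf η t‖ ≤ ∫ ω, ‖chf η ((A (j ω) ω)ᵀ *ᵥ t)‖ ∂P := by
  have integrable_select : Integrable (fun ω => ‖chf η ((A (j ω) ω)ᵀ *ᵥ t)‖) P :=
    (integrable_const (1 : ℝ)).mono' ((continuous_chf η).norm.measurable.comp
      (measurable_transpose_mulVec_select hA hj t)).aestronglyMeasurable
      (ae_of_all _ fun ω => (norm_norm _).trans_le (norm_chf_le_one η _))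
  refine (norm_chf_le_integral_prod hN hA hη t).trans (integral_mono_of_nonneg
    (ae_of_all _ fun ω => Finset.prod_nonneg fun _ _ => norm_nonneg _) integrable_select ?_)
  filter_upwards [hj_lt] with ω hω
  rw [← Finset.mul_prod_erase _ _ (Finset.mem_range.2 hω)]
  exact mul_le_of_le_one_right (norm_nonneg _)
    (Finset.prod_le_one (fun _ _ => norm_nonneg _) fun _ _ => norm_chf_le_one η _)

lemma exists_childStep (hN : Measurable N) (hA : ∀ i, Measurable (A i))
    (hzero : ∀ᵐ ω ∂P, ∀ i, N ω ≤ i → A i ω = 0) (h_active : ActivityCondition P A)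
    (hη : smoothingTransform P N A η = η) {s ρ K : ℝ} {w : (Fin d → ℝ) → ℝ}
    (hw : IsLyapunov P N A s ρ K w) :
    ∃ ε C : ℝ, 0 < ε ∧ 0 < C ∧ ∀ t ≠ 0, ∃ j : Ω → ℕ, (∀ᵐ ω ∂P, j ω < N ω) ∧
      ChildStep P (fun t => ‖chf η t‖) w ρ ε C t fun ω => (A (j ω) ω)ᵀ *ᵥ t := by
  obtain ⟨ε, C, hε, hC, hindex⟩ := h_active.exists_index_integral_rpow_neg_le hA
  refine ⟨ε, C, hε, hC, fun t ht => ?_⟩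
  obtain ⟨j, hj, ne_zero, integrable_rpow, integral_rpow_le⟩ := hindex t ht
  have hj_lt : ∀ᵐ ω ∂P, j ω < N ω := by
    filter_upwards [hzero, ne_zero] with ω hω using lt_of_transpose_mulVec_ne_zero hω
  obtain ⟨integrable_w, integral_w_le⟩ := hw.integrable_and_integral_select_le hA hj hj_lt t
  exact ⟨j, hj_lt, measurable_transpose_mulVec_select hA hj t, ne_zero, integrable_w,
    integral_w_le, integrable_rpow, integral_rpow_le,
    norm_chf_le_integral_select hN hA hη hj hj_lt t⟩

end Children

section TwoLarge

variable {Ω : Type*} {d : ℕ} {A : ℕ → Ω → Matrix (Fin d) (Fin d) ℝ}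

/-- The event that at least two of the vectors `A_iᵀ t` have norm at least one; on it at least two
factors in the fixed point equation for the characteristic function are evaluated far from `0`. -/
def twoLarge (A : ℕ → Ω → Matrix (Fin d) (Fin d) ℝ) (t : Fin d → ℝ) : Set Ω :=
  {ω | ∃ i j, i ≠ j ∧ 1 ≤ l1norm ((A i ω)ᵀ *ᵥ t) ∧ 1 ≤ l1norm ((A j ω)ᵀ *ᵥ t)}

lemma measurableSet_twoLarge [MeasurableSpace Ω] (hA : ∀ i, Measurable (A i)) (t : Fin d → ℝ) :
    MeasurableSet (twoLarge A t) := by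
  have measurableSet_large (i : ℕ) : MeasurableSet {ω | 1 ≤ l1norm ((A i ω)ᵀ *ᵥ t)} :=
    measurableSet_le measurable_const
      (continuous_l1norm.measurable.comp ((measurable_transpose_mulVec_const t).comp (hA i)))
  simp only [twoLarge, Set.ofPred_exists]
  exact .iUnion fun i => .iUnion fun j =>
    (MeasurableSet.const _).inter ((measurableSet_large i).inter (measurableSet_large j))

lemma exists_tendsto_normalize_subseq {t : ℕ → Fin d → ℝ} (ht : ∀ n, t n ≠ 0) :
    ∃ u, u ≠ 0 ∧ ∃ φ : ℕ → ℕ, StrictMono φ ∧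
      Tendsto (fun n => (l1norm (t (φ n)))⁻¹ • t (φ n)) atTop (𝓝 u) := by
  obtain ⟨u, hu, φ, hφ, hlim⟩ := (isCompact_l1norm_annulus 1 1).tendsto_subseq
    (x := fun n => (l1norm (t n))⁻¹ • t n)
    fun n => ⟨(l1norm_normalize (ht n)).ge, (l1norm_normalize (ht n)).le⟩
  exact ⟨u, ne_zero_of_one_le_l1norm hu.1, φ, hφ, hlim⟩

lemma eventually_one_le_l1norm_transpose_mulVec {t : ℕ → Fin d → ℝ} {u : Fin d → ℝ}
    (ht : Tendsto (fun n => l1norm (t n)) atTop atTop)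
    (hu : Tendsto (fun n => (l1norm (t n))⁻¹ • t n) atTop (𝓝 u))
    {a : Matrix (Fin d) (Fin d) ℝ} (ha : aᵀ *ᵥ u ≠ 0) :
    ∀ᶠ n in atTop, 1 ≤ l1norm (aᵀ *ᵥ t n) := by
  have tendsto_direction : Tendsto (fun n => l1norm (aᵀ *ᵥ ((l1norm (t n))⁻¹ • t n))) atTop
      (𝓝 (l1norm (aᵀ *ᵥ u))) :=
    ((continuous_l1norm.comp (continuous_const.matrix_mulVec continuous_id)).tendsto u).comp hu
  filter_upwards [(ht.atTop_mul_pos (l1norm_pos ha) tendsto_direction).eventually_ge_atTop 1,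
    ht.eventually_ge_atTop 1] with n hn ht_large
  have ht_ne := ne_zero_of_one_le_l1norm ht_large
  rwa [transpose_mulVec_eq_smul_normalize a ht_ne, l1norm_smul, abs_of_pos (l1norm_pos ht_ne)]

variable [MeasurableSpace Ω] {P : Measure Ω} [IsProbabilityMeasure P]

lemma ActivityCondition.not_ae_activeCount_le_one (h_active : ActivityCondition P A)
    {u : Fin d → ℝ} (hu : u ≠ 0) : ¬ ∀ᵐ ω ∂P, activeCount A u ω ≤ 1 := by
  intro hle
  have hone : {ω | activeCount A u ω = 1} =ᵐ[P] Set.univ := by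
    refine eventuallyEq_univ.2 ?_
    filter_upwards [hle, h_active.one_le] with ω hω hge using le_antisymm hω (hge u hu)
  exact (h_active.prob_lt_one u hu).ne ((measure_congr hone).trans measure_univ)

/-- Otherwise directions along which the probability is small would accumulate at a direction `u`,
and almost surely at most one `A_iᵀ u` would be nonzero. -/
lemma ActivityCondition.exists_le_measureReal_twoLarge (h_active : ActivityCondition P A) :
    ∃ p R : ℝ, 0 < p ∧ ∀ t, R ≤ l1norm t → p ≤ P.real (twoLarge A t) := by
  by_contra! hcon
  choose t t_large prob_lt using fun n : ℕ => hcon ((1 / 2) ^ n) (n + 1) (by positivity)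
  have t_ne_zero (n : ℕ) : t n ≠ 0 :=
    ne_zero_of_one_le_l1norm ((le_add_of_nonneg_left n.cast_nonneg).trans (t_large n))
  obtain ⟨u, hu, φ, hφ, hlim⟩ := exists_tendsto_normalize_subseq t_ne_zero
  have tendsto_t : Tendsto (fun n => l1norm (t (φ n))) atTop atTop :=
    tendsto_atTop_mono (fun n => (lt_add_one _).le.trans (t_large (φ n)))
      (tendsto_natCast_atTop_atTop.comp hφ.tendsto_atTop)
  have prob_le (n : ℕ) : P (twoLarge A (t (φ n))) ≤ (1 / 2) ^ n := by
    calc P (twoLarge A (t (φ n))) = ENNReal.ofReal (P.real (twoLarge A (t (φ n)))) :=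
          (ofReal_measureReal).symm
      _ ≤ ENNReal.ofReal ((1 / 2) ^ n) := ENNReal.ofReal_le_ofReal <| (prob_lt _).le.trans <|
          pow_le_pow_of_le_one (by norm_num) (by norm_num) (hφ.id_le n)
      _ = (1 / 2) ^ n := by
          rw [ENNReal.ofReal_pow (by norm_num), ENNReal.ofReal_div_of_pos two_pos,
            ENNReal.ofReal_one, ENNReal.ofReal_ofNat]
  have tsum_ne_top : ∑' n, P (twoLarge A (t (φ n))) ≠ ∞ :=
    ne_top_of_le_ne_top (by simp [ENNReal.tsum_geometric]) (ENNReal.tsum_le_tsum prob_le)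
  refine h_active.not_ae_activeCount_le_one hu ?_
  filter_upwards [ae_eventually_notMem tsum_ne_top] with ω hω
  by_contra! hcount
  obtain ⟨i, j, hi, hj, hij⟩ := Set.one_lt_encard_iff.1 hcount
  obtain ⟨n, hn, hi_large, hj_large⟩ :=
    (hω.and ((eventually_one_le_l1norm_transpose_mulVec tendsto_t hlim hi).and
      (eventually_one_le_l1norm_transpose_mulVec tendsto_t hlim hj))).exists
  exact hn ⟨i, j, hij, hi_large, hj_large⟩

end TwoLarge

/-! ### The characteristic function is bounded away from one -/

section Unimodular

variable {Ω : Type*} [MeasurableSpace Ω] {d : ℕ} {P : Measure Ω} [IsProbabilityMeasure P]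
  {h w : (Fin d → ℝ) → ℝ} {ρ ε C : ℝ} {t : Fin d → ℝ} {T : Ω → Fin d → ℝ}

lemma ChildStep.integrable_comp (hT : ChildStep P h w ρ ε C t T) (continuous_h : Continuous h)
    (h_nonneg : ∀ t, 0 ≤ h t) (h_le_one : ∀ t, h t ≤ 1) : Integrable (fun ω => h (T ω)) P :=
  (integrable_const (1 : ℝ)).mono'
    (continuous_h.measurable.comp hT.measurable).aestronglyMeasurable
    (ae_of_all _ fun _ => (Real.norm_of_nonneg (h_nonneg _)).trans_le (h_le_one _))

lemma ChildStep.ae_eq_one (hT : ChildStep P h w ρ ε C t T) (continuous_h : Continuous h)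
    (h_nonneg : ∀ t, 0 ≤ h t) (h_le_one : ∀ t, h t ≤ 1) (ht : h t = 1) :
    ∀ᵐ ω ∂P, h (T ω) = 1 := by
  have integrable_h := hT.integrable_comp continuous_h h_nonneg h_le_one
  have defect_nonneg : 0 ≤ fun ω => 1 - h (T ω) := fun ω => sub_nonneg.2 (h_le_one _)
  have integral_defect : ∫ ω, (1 - h (T ω)) ∂P = 0 := by
    refine le_antisymm ?_ (integral_nonneg defect_nonneg)
    rw [integral_sub (integrable_const _) integrable_h, integral_const, probReal_univ, one_smul,
      sub_nonpos, ← ht]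
    exact hT.le_integral
  filter_upwards [(integral_eq_zero_iff_of_nonneg defect_nonneg
    ((integrable_const _).sub integrable_h)).1 integral_defect] with ω hω
  exact (sub_eq_zero.1 hω).symm

lemma ChildStep.exists_eq_one_and_lyapunov_le (hT : ChildStep P h w ρ ε C t T)
    (continuous_h : Continuous h) (h_nonneg : ∀ t, 0 ≤ h t) (h_le_one : ∀ t, h t ≤ 1)
    (ht : h t = 1) : ∃ t', (t' ≠ 0 ∧ h t' = 1) ∧ w t' ≤ ρ * w t := by
  have hT_good : ∀ᵐ ω ∂P, T ω ≠ 0 ∧ h (T ω) = 1 :=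
    hT.ne_zero.and (hT.ae_eq_one continuous_h h_nonneg h_le_one ht)
  obtain ⟨ω, hω, hle⟩ := exists_notMem_null_le_integral hT.integrable_lyapunov hT_good
  exact ⟨T ω, not_not.1 hω, hle.trans hT.integral_lyapunov_le⟩

lemma exists_seq_lyapunov_le_of_eq_one (hρ : 0 ≤ ρ) (continuous_h : Continuous h)
    (h_nonneg : ∀ t, 0 ≤ h t) (h_le_one : ∀ t, h t ≤ 1)
    (hstep : ∀ t ≠ 0, ∃ T, ChildStep P h w ρ ε C t T) (ht_ne : t ≠ 0) (ht : h t = 1) :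
    ∃ x : ℕ → Fin d → ℝ, (∀ n, x n ≠ 0 ∧ h (x n) = 1) ∧ ∀ n, w (x n) ≤ ρ ^ n * w t := by
  have hnext (t : {t : Fin d → ℝ // t ≠ 0 ∧ h t = 1}) :
      ∃ t' : {t : Fin d → ℝ // t ≠ 0 ∧ h t = 1}, w t' ≤ ρ * w t := by
    obtain ⟨T, hT⟩ := hstep t t.2.1
    obtain ⟨t', ht', hle⟩ := hT.exists_eq_one_and_lyapunov_le continuous_h h_nonneg h_le_one t.2.2
    exact ⟨⟨t', ht'⟩, hle⟩
  choose next hnext using hnext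
  refine ⟨fun n => next^[n] ⟨t, ht_ne, ht⟩, fun n => (next^[n] ⟨t, ht_ne, ht⟩).2, fun n => ?_⟩
  induction n with
  | zero => simp
  | succ n ih =>
    simp only [Function.iterate_succ_apply', pow_succ', mul_assoc]
    exact (hnext _).trans (mul_le_mul_of_nonneg_left ih hρ)

lemma tendsto_l1norm_zero_of_rpow_le {s : ℝ} (hs : 0 < s) {x : ℕ → Fin d → ℝ} {b : ℕ → ℝ}
    (hle : ∀ n, l1norm (x n) ^ s ≤ b n) (hb : Tendsto b atTop (𝓝 0)) :
    Tendsto (fun n => l1norm (x n)) atTop (𝓝 0) := by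
  have tendsto_rpow : Tendsto (fun n => l1norm (x n) ^ s) atTop (𝓝 0) :=
    squeeze_zero (fun n => Real.rpow_nonneg (l1norm_nonneg _) s) hle hb
  have := tendsto_rpow.rpow_const (p := s⁻¹) (Or.inr (by positivity))
  simpa only [Real.rpow_rpow_inv (l1norm_nonneg _) hs.ne', Real.zero_rpow (inv_ne_zero hs.ne')]
    using this

end Unimodular

section NonDegenerate

lemma eq_of_exp_mul_I_eq {x y : ℝ} (hxy : |x - y| < 2 * Real.pi)
    (hexp : Complex.exp ((x : ℂ) * Complex.I) = Complex.exp ((y : ℂ) * Complex.I)) : x = y := by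
  have exp_sub : Complex.exp (((x - y : ℝ) : ℂ) * Complex.I) = 1 := by
    rw [Complex.ofReal_sub, sub_mul, Complex.exp_sub, hexp, div_self (Complex.exp_ne_zero _)]
  have cos_sub : Real.cos (x - y) = 1 := by
    rw [← Complex.exp_ofReal_mul_I_re, exp_sub, Complex.one_re]
  obtain ⟨hlt, hgt⟩ := abs_lt.1 hxy
  exact sub_eq_zero.1 ((Real.cos_eq_one_iff_of_lt_of_lt hlt hgt).1 cos_sub)

variable {d : ℕ} {η : Measure (Fin d → ℝ)} [IsProbabilityMeasure η]

lemma ae_exp_eq_of_norm_chf_eq_one {t : Fin d → ℝ} (ht : ‖chf η t‖ = 1) :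
    ∀ᵐ x ∂η, Complex.exp (((t ⬝ᵥ x : ℝ) : ℂ) * Complex.I) = chf η t := by
  have norm_exp_le : ∀ᵐ x ∂η, ‖Complex.exp (((t ⬝ᵥ x : ℝ) : ℂ) * Complex.I)‖ ≤ 1 :=
    ae_of_all _ fun x => (Complex.norm_exp_ofReal_mul_I _).le
  rcases ae_eq_const_or_norm_integral_lt_of_norm_le_const norm_exp_le with hconst | hlt
  · filter_upwards [hconst] with x hx
    rw [hx, Function.const_apply, average_eq_integral, chf_apply]
  · rw [← chf_apply, ht, probReal_univ, one_mul] at hlt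
    exact absurd hlt (lt_irrefl 1)

lemma eventually_dotProduct_eq_of_exp_eq {t : ℕ → Fin d → ℝ}
    (hlim : Tendsto (fun n => l1norm (t n)) atTop (𝓝 0)) {x y : Fin d → ℝ}
    (hexp : ∀ n, Complex.exp (((t n ⬝ᵥ x : ℝ) : ℂ) * Complex.I) =
      Complex.exp (((t n ⬝ᵥ y : ℝ) : ℂ) * Complex.I)) :
    ∀ᶠ n in atTop, t n ⬝ᵥ (x - y) = 0 := by
  have tendsto_bound : Tendsto (fun n => l1norm (t n) * l1norm (x - y)) atTop (𝓝 0) := by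
    simpa using hlim.mul_const (l1norm (x - y))
  filter_upwards [tendsto_bound.eventually (eventually_lt_nhds Real.two_pi_pos)] with n hn
  have abs_lt_two_pi : |t n ⬝ᵥ x - t n ⬝ᵥ y| < 2 * Real.pi := by
    rw [← dotProduct_sub]
    exact (abs_dotProduct_le _ _).trans_lt hn
  rw [dotProduct_sub, eq_of_exp_mul_I_eq abs_lt_two_pi (hexp n), sub_self]

lemma exists_ae_dotProduct_eq_const {t : ℕ → Fin d → ℝ} (ht : ∀ n, t n ≠ 0 ∧ ‖chf η (t n)‖ = 1)
    (hlim : Tendsto (fun n => l1norm (t n)) atTop (𝓝 0)) :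
    ∃ u : Fin d → ℝ, u ≠ 0 ∧ ∃ c : ℝ, ∀ᵐ x ∂η, u ⬝ᵥ x = c := by
  have exp_eq : ∀ᵐ x ∂η, ∀ n, Complex.exp (((t n ⬝ᵥ x : ℝ) : ℂ) * Complex.I) = chf η (t n) :=
    ae_all_iff.2 fun n => ae_exp_eq_of_norm_chf_eq_one (ht n).2
  obtain ⟨x₀, hx₀⟩ := exp_eq.exists
  obtain ⟨u, hu, φ, hφ, hdir⟩ := exists_tendsto_normalize_subseq fun n => (ht n).1
  refine ⟨u, hu, u ⬝ᵥ x₀, ?_⟩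
  filter_upwards [exp_eq] with x hx
  have eventually_zero :=
    eventually_dotProduct_eq_of_exp_eq hlim fun n => (hx n).trans (hx₀ n).symm
  have tendsto_dot : Tendsto (fun n => ((l1norm (t (φ n)))⁻¹ • t (φ n)) ⬝ᵥ (x - x₀)) atTop
      (𝓝 (u ⬝ᵥ (x - x₀))) :=
    ((continuous_id.dotProduct continuous_const).tendsto u).comp hdir
  have tendsto_zero : Tendsto (fun n => ((l1norm (t (φ n)))⁻¹ • t (φ n)) ⬝ᵥ (x - x₀)) atTop
      (𝓝 0) := by
    refine tendsto_const_nhds.congr' ?_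
    filter_upwards [hφ.tendsto_atTop.eventually eventually_zero] with n hn
    rw [smul_dotProduct, hn, smul_zero]
  rw [← sub_eq_zero, ← dotProduct_sub]
  exact tendsto_nhds_unique tendsto_dot tendsto_zero

variable {Ω : Type*} [MeasurableSpace Ω] {P : Measure Ω} [IsProbabilityMeasure P]
  {w : (Fin d → ℝ) → ℝ} {s ρ ε C : ℝ}

lemma norm_chf_lt_one (hs : 0 < s) (hρ : 0 ≤ ρ) (hρ_lt : ρ < 1)
    (w_ge : ∀ t, l1norm t ^ s ≤ w t)
    (hstep : ∀ t ≠ 0, ∃ T, ChildStep P (fun t => ‖chf η t‖) w ρ ε C t T)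
    (h_nondeg : ∀ t : Fin d → ℝ, t ≠ 0 → ∀ c : ℝ, ¬ ∀ᵐ x ∂η, t ⬝ᵥ x = c)
    {t : Fin d → ℝ} (ht : t ≠ 0) : ‖chf η t‖ < 1 := by
  refine (norm_chf_le_one η t).lt_of_ne fun ht_one => ?_
  obtain ⟨x, hx, w_le⟩ := exists_seq_lyapunov_le_of_eq_one hρ (continuous_chf η).norm
    (fun _ => norm_nonneg _) (norm_chf_le_one η) hstep ht ht_one
  have tendsto_rate : Tendsto (fun n : ℕ => ρ ^ n * w t) atTop (𝓝 0) := by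
    simpa using (tendsto_pow_atTop_nhds_zero_of_lt_one hρ hρ_lt).mul_const (w t)
  obtain ⟨u, hu, c, hc⟩ := exists_ae_dotProduct_eq_const hx
    (tendsto_l1norm_zero_of_rpow_le hs (fun n => (w_ge _).trans (w_le n)) tendsto_rate)
  exact h_nondeg u hu c hc

end NonDegenerate

section Gap

lemma forall_le_of_upper_bound_improves {α : Type*} {S : Set α} {F : α → ℝ} {b : ℝ}
    (hbdd : BddAbove (F '' S))
    (improve : ∀ M > b, (∀ x ∈ S, F x ≤ M) → ∃ M' < M, ∀ x ∈ S, F x ≤ M') :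
    ∀ x ∈ S, F x ≤ b := by
  by_contra! hcon
  obtain ⟨x, hx, hlt⟩ := hcon
  have le_sup (y : α) (hy : y ∈ S) : F y ≤ sSup (F '' S) := le_csSup hbdd ⟨y, hy, rfl⟩
  obtain ⟨M', hM', le_M'⟩ := improve _ (hlt.trans_le (le_sup x hx)) le_sup
  exact hM'.not_ge (csSup_le ⟨F x, x, hx, rfl⟩ (Set.forall_mem_image.2 le_M'))

lemma rpow_neg_ge_tangent {x y θ : ℝ} (hx : 0 < x) (hy : 0 < y) (hθ : 0 ≤ θ) :
    y ^ (-θ) * (1 - θ * (x / y - 1)) ≤ x ^ (-θ) := by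
  have rpow_eq : x ^ (-θ) = y ^ (-θ) * Real.exp (-θ * Real.log (x / y)) := by
    rw [Real.rpow_def_of_pos hx, Real.rpow_def_of_pos hy, ← Real.exp_add,
      Real.log_div hx.ne' hy.ne']
    ring_nf
  rw [rpow_eq]
  refine mul_le_mul_of_nonneg_left ?_ (by positivity)
  calc 1 - θ * (x / y - 1) ≤ -θ * Real.log (x / y) + 1 := by
        linarith [mul_le_mul_of_nonneg_left (Real.log_le_sub_one_of_pos (div_pos hx hy)) hθ]
    _ ≤ Real.exp (-θ * Real.log (x / y)) := Real.add_one_le_exp _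

variable {d : ℕ} {h w : (Fin d → ℝ) → ℝ} {s ρ ε C c θ κ M : ℝ}

/-- The function `h` corrected by `w^{-θ}`, which makes it a strict submartingale along large
children, and by `-κ w`, which makes an upper bound improve by a definite amount; eventually
`κ → 0`. -/
def gapPotential (h w : (Fin d → ℝ) → ℝ) (c θ κ : ℝ) (t : Fin d → ℝ) : ℝ :=
  h t + c * (1 + w t ^ (-θ) - κ * w t)

lemma gapPotential_le_add_rpow_neg (hs : 0 < s) (hθ : 0 < θ) (hsθ : s * θ ≤ ε) (hκ : 0 ≤ κ)
    (hc : 0 ≤ c) (w_ge : ∀ t, l1norm t ^ s ≤ w t) (h_le_one : ∀ t, h t ≤ 1) (hM : 1 ≤ M)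
    (bound : ∀ t, 1 ≤ l1norm t → gapPotential h w c θ κ t ≤ M) {t : Fin d → ℝ} (ht : t ≠ 0) :
    gapPotential h w c θ κ t ≤ M + 2 * c * l1norm t ^ (-ε) := by
  have t_pos := l1norm_pos ht
  rcases le_or_gt 1 (l1norm t) with large | small
  · exact (bound t large).trans (le_add_of_nonneg_right (by positivity))
  have one_le : 1 ≤ l1norm t ^ (-ε) :=
    Real.one_le_rpow_of_pos_of_le_one_of_nonpos t_pos small.le (by nlinarith)
  have w_rpow_le : w t ^ (-θ) ≤ l1norm t ^ (-ε) :=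
    calc w t ^ (-θ) ≤ (l1norm t ^ s) ^ (-θ) :=
          Real.rpow_le_rpow_of_nonpos (by positivity) (w_ge t) (by linarith)
      _ = l1norm t ^ (-(s * θ)) := by rw [← Real.rpow_mul t_pos.le, mul_neg]
      _ ≤ l1norm t ^ (-ε) := Real.rpow_le_rpow_of_exponent_ge t_pos small.le (by linarith)
  have κw_nonneg : 0 ≤ κ * w t :=
    mul_nonneg hκ ((Real.rpow_nonneg t_pos.le s).trans (w_ge t))
  calc h t + c * (1 + w t ^ (-θ) - κ * w t)
      ≤ M + c * (l1norm t ^ (-ε) + l1norm t ^ (-ε) - 0) := by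
        gcongr
        exact (h_le_one t).trans hM
    _ = M + 2 * c * l1norm t ^ (-ε) := by ring

lemma exists_rpow_neg_le_lyapunov_rpow_neg (hθ : 0 < θ) (hsθ : s * θ < ε) {K : ℝ}
    (hK : 0 < K) (w_ge : ∀ t, l1norm t ^ s ≤ w t) (w_le : ∀ t, w t ≤ K * l1norm t ^ s) (D : ℝ)
    {b : ℝ} (hb : 0 < b) :
    ∃ R, ∀ t : Fin d → ℝ, 1 ≤ l1norm t → R ≤ l1norm t → D * l1norm t ^ (-ε) ≤ b * w t ^ (-θ) := by
  have tendsto_zero : Tendsto (fun r : ℝ => D * r ^ (-(ε - s * θ))) atTop (𝓝 0) := by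
    simpa using (tendsto_rpow_neg_atTop (sub_pos.2 hsθ)).const_mul D
  obtain ⟨R, hR⟩ := eventually_atTop.1
    (tendsto_zero.eventually (eventually_le_nhds (show 0 < b * K ^ (-θ) by positivity)))
  refine ⟨R, fun t ht htR => ?_⟩
  have t_pos : 0 < l1norm t := one_pos.trans_le ht
  have w_pos : 0 < w t := (Real.rpow_pos_of_pos t_pos s).trans_le (w_ge t)
  calc D * l1norm t ^ (-ε) = D * l1norm t ^ (-(ε - s * θ)) * l1norm t ^ (-(s * θ)) := by
        rw [mul_assoc, ← Real.rpow_add t_pos]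
        ring_nf
    _ ≤ b * K ^ (-θ) * l1norm t ^ (-(s * θ)) := by
        exact mul_le_mul_of_nonneg_right (hR _ htR) (by positivity)
    _ = b * (K * l1norm t ^ s) ^ (-θ) := by
        rw [Real.mul_rpow hK.le (by positivity), ← Real.rpow_mul t_pos.le, mul_neg, mul_assoc]
    _ ≤ b * w t ^ (-θ) := by
        gcongr 1
        exact Real.rpow_le_rpow_of_nonpos w_pos (w_le t) (by linarith)

variable {Ω : Type*} [MeasurableSpace Ω] {P : Measure Ω} [IsProbabilityMeasure P]

lemma ChildStep.gapPotential_improves {t : Fin d → ℝ} {T : Ω → Fin d → ℝ}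
    (hT : ChildStep P h w ρ ε C t T) (ht : t ≠ 0) (continuous_h : Continuous h)
    (h_nonneg : ∀ t, 0 ≤ h t) (h_le_one : ∀ t, h t ≤ 1) (w_pos : ∀ t ≠ 0, 0 < w t) (hθ : 0 ≤ θ)
    (hκ : 0 ≤ κ) (hc : 0 ≤ c)
    (bound : ∀ t ≠ 0, gapPotential h w c θ κ t ≤ M + 2 * c * l1norm t ^ (-ε))
    (large : 2 * C * l1norm t ^ (-ε) ≤ θ * (1 - ρ) * w t ^ (-θ)) :
    gapPotential h w c θ κ t ≤ M - c * κ * (1 - ρ) * w t := by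
  have wt_pos := w_pos t ht
  set Y := w t ^ (-θ)
  have h_le : ∀ᵐ ω ∂P, h (T ω) ≤ (M - c * (1 + Y * (1 + θ)))
      + c * (θ * (Y / w t) + κ) * w (T ω) + 2 * c * l1norm (T ω) ^ (-ε) := by
    filter_upwards [hT.ne_zero] with ω hω
    have tangent := mul_le_mul_of_nonneg_left
      (rpow_neg_ge_tangent (w_pos _ hω) wt_pos hθ) hc
    have potential_le := bound _ hω
    rw [gapPotential] at potential_le
    linear_combination potential_le + tangent
  have integrable_const_term : Integrable (fun _ : Ω => M - c * (1 + Y * (1 + θ))) P :=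
    integrable_const _
  have integrable_w := hT.integrable_lyapunov.const_mul (c * (θ * (Y / w t) + κ))
  have integrable_rpow := hT.integrable_rpow.const_mul (2 * c)
  have integral_h_le := integral_mono_ae (hT.integrable_comp continuous_h h_nonneg h_le_one)
    ((integrable_const_term.add integrable_w).add integrable_rpow) h_le
  rw [integral_add' (integrable_const_term.add integrable_w) integrable_rpow,
    integral_add' integrable_const_term integrable_w, integral_const_mul, integral_const_mul,
    integral_const, probReal_univ, one_smul] at integral_h_le
  have : 0 < Y := by positivity
  have w_term : c * (θ * (Y / w t) + κ) * ∫ ω, w (T ω) ∂P ≤ c * (θ * Y * ρ + κ * ρ * w t) :=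
    calc c * (θ * (Y / w t) + κ) * ∫ ω, w (T ω) ∂P
        ≤ c * (θ * (Y / w t) + κ) * (ρ * w t) := by
          gcongr
          exact hT.integral_lyapunov_le
      _ = c * (θ * Y * ρ + κ * ρ * w t) := by field_simp
  have rpow_term : 2 * c * ∫ ω, l1norm (T ω) ^ (-ε) ∂P ≤ c * (θ * (1 - ρ) * Y) :=
    calc 2 * c * ∫ ω, l1norm (T ω) ^ (-ε) ∂P ≤ 2 * c * (C * l1norm t ^ (-ε)) := by
          gcongr
          exact hT.integral_rpow_le
      _ = c * (2 * C * l1norm t ^ (-ε)) := by ring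
      _ ≤ c * (θ * (1 - ρ) * Y) := by gcongr
  rw [gapPotential]
  linear_combination hT.le_integral + integral_h_le + w_term + rpow_term

lemma gapPotential_le_add (hκ : 0 ≤ κ) (hc : 0 ≤ c) (hθ : 0 ≤ θ) {t : Fin d → ℝ}
    (w_ge_one : 1 ≤ w t) : gapPotential h w c θ κ t ≤ h t + 2 * c := by
  have w_rpow_le : w t ^ (-θ) ≤ 1 := Real.rpow_le_one_of_one_le_of_nonpos w_ge_one (by linarith)
  have : 0 ≤ κ * w t := by positivity
  calc h t + c * (1 + w t ^ (-θ) - κ * w t) ≤ h t + c * (1 + 1 - 0) := by gcongr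
    _ = h t + 2 * c := by ring

lemma gapPotential_le_one (hs : 0 < s) (hθ : 0 < θ) (hsθ : s * θ ≤ ε) (hκ : 0 < κ) (hc : 0 < c)
    (hρ_lt : ρ < 1) (w_ge : ∀ t, l1norm t ^ s ≤ w t) (continuous_h : Continuous h)
    (h_nonneg : ∀ t, 0 ≤ h t) (h_le_one : ∀ t, h t ≤ 1)
    (hstep : ∀ t ≠ 0, ∃ T, ChildStep P h w ρ ε C t T) {R : ℝ}
    (near : ∀ t, 1 ≤ l1norm t → l1norm t ≤ R → h t ≤ 1 - 2 * c)
    (far : ∀ t : Fin d → ℝ, 1 ≤ l1norm t → R ≤ l1norm t →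
      2 * C * l1norm t ^ (-ε) ≤ θ * (1 - ρ) * w t ^ (-θ)) :
    ∀ t, 1 ≤ l1norm t → gapPotential h w c θ κ t ≤ 1 := by
  have w_ge_one {t : Fin d → ℝ} (ht : 1 ≤ l1norm t) : 1 ≤ w t :=
    (Real.one_le_rpow ht hs.le).trans (w_ge t)
  have le_add {t : Fin d → ℝ} (ht : 1 ≤ l1norm t) : gapPotential h w c θ κ t ≤ h t + 2 * c :=
    gapPotential_le_add hκ.le hc.le hθ.le (w_ge_one ht)
  refine forall_le_of_upper_bound_improves (S := {t | 1 ≤ l1norm t})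
    ⟨1 + 2 * c, Set.forall_mem_image.2 fun t ht => (le_add ht).trans (by linarith [h_le_one t])⟩ ?_
  intro M hM bound
  have gain_pos : 0 < c * κ * (1 - ρ) := mul_pos (mul_pos hc hκ) (sub_pos.2 hρ_lt)
  refine ⟨max 1 (M - c * κ * (1 - ρ)), max_lt hM (by linarith), fun t ht => ?_⟩
  rcases le_total (l1norm t) R with near_t | far_t
  · exact le_max_of_le_left ((le_add ht).trans (by linarith [near t ht near_t]))
  have ht_ne := ne_zero_of_one_le_l1norm ht
  obtain ⟨T, hT⟩ := hstep t ht_ne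
  refine le_max_of_le_right ((hT.gapPotential_improves ht_ne continuous_h h_nonneg h_le_one
    (fun t ht => (Real.rpow_pos_of_pos (l1norm_pos ht) s).trans_le (w_ge t)) hθ.le hκ.le hc.le
    (fun _ => gapPotential_le_add_rpow_neg hs hθ hsθ hκ.le hc.le w_ge h_le_one hM.le bound)
    (far t ht far_t)).trans ?_)
  linarith [le_mul_of_one_le_right gain_pos.le (w_ge_one ht)]

lemma exists_gap (hs : 0 < s) (hε : 0 < ε) (hρ_lt : ρ < 1) {K : ℝ}
    (w_ge : ∀ t, l1norm t ^ s ≤ w t) (w_le : ∀ t, w t ≤ K * l1norm t ^ s)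
    (continuous_h : Continuous h) (h_nonneg : ∀ t, 0 ≤ h t) (h_le_one : ∀ t, h t ≤ 1)
    (h_lt_one : ∀ t ≠ 0, h t < 1) (hstep : ∀ t ≠ 0, ∃ T, ChildStep P h w ρ ε C t T) :
    ∃ l < 1, ∀ t, 1 ≤ l1norm t → h t ≤ l := by
  set θ := ε / (2 * s)
  have hθ : 0 < θ := by positivity
  have hsθ : s * θ = ε / 2 := by
    simp only [θ]
    field_simp
  have w_le_max (t : Fin d → ℝ) : w t ≤ max K 1 * l1norm t ^ s :=
    (w_le t).trans (mul_le_mul_of_nonneg_right (le_max_left K 1)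
      (Real.rpow_nonneg (l1norm_nonneg t) s))
  obtain ⟨R, far⟩ := exists_rpow_neg_le_lyapunov_rpow_neg hθ (by linarith : s * θ < ε)
    (by positivity) w_ge w_le_max (2 * C) (mul_pos hθ (sub_pos.2 hρ_lt))
  obtain ⟨b, hb, near⟩ := (isCompact_l1norm_annulus (d := d) 1 R).exists_forall_le'
    (f := fun t => 1 - h t) (continuous_const.sub continuous_h).continuousOn
    fun t ht => sub_pos.2 (h_lt_one t (ne_zero_of_one_le_l1norm ht.1))
  obtain ⟨c, hc, rfl⟩ : ∃ c, 0 < c ∧ b = 2 * c := ⟨b / 2, half_pos hb, by ring⟩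
  refine ⟨1 - c, sub_lt_self 1 hc, fun t ht => ?_⟩
  have potential_le : ∀ᶠ κ in 𝓝[>] 0, gapPotential h w c θ κ t ≤ 1 := by
    filter_upwards [self_mem_nhdsWithin] with κ hκ
    exact gapPotential_le_one hs hθ (by linarith) hκ hc hρ_lt w_ge continuous_h h_nonneg h_le_one
      hstep (fun t ht htR => by linarith [near t ⟨ht, htR⟩]) far t ht
  have tendsto_potential : Tendsto (fun κ => gapPotential h w c θ κ t) (𝓝[>] 0)
      (𝓝 (gapPotential h w c θ 0 t)) :=
    (Continuous.tendsto (by unfold gapPotential; fun_prop) 0).mono_left nhdsWithin_le_nhds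
  have limit_le := le_of_tendsto tendsto_potential potential_le
  have w_pos : 0 < w t := (Real.rpow_pos_of_pos (one_pos.trans_le ht) s).trans_le (w_ge t)
  rw [gapPotential] at limit_le
  nlinarith [Real.rpow_pos_of_pos w_pos (-θ)]

end Gap

/-! ### Polynomial decay -/

section Truncation

lemma max_one_rpow_le {x a ε : ℝ} (hx : 0 < x) (ha : 0 < a) (haε : a ≤ ε) :
    max 1 x ^ a ≤ 1 + a / ε * x ^ ε := by
  have hε : 0 < ε := ha.trans_le haε
  rcases le_total x 1 with hx_le | hx_ge
  · rw [max_eq_left hx_le, Real.one_rpow, le_add_iff_nonneg_right]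
    positivity
  calc max 1 x ^ a = (1 + (x ^ ε - 1)) ^ (a / ε) := by
        rw [max_eq_right hx_ge, add_sub_cancel, ← Real.rpow_mul hx.le, mul_div_cancel₀ _ hε.ne']
    _ ≤ 1 + a / ε * (x ^ ε - 1) := rpow_one_add_le_one_add_mul_self
        (by linarith [Real.rpow_nonneg hx.le ε]) (by positivity) ((div_le_one hε).2 haε)
    _ ≤ 1 + a / ε * x ^ ε := by gcongr; exact sub_le_self _ zero_le_one

lemma min_rpow_le_mul_max_rpow {τ r R a : ℝ} (hτ : 0 < τ) (hr : 0 < r) (hR : 0 < R)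
    (ha : 0 ≤ a) : min τ R ^ a ≤ min r R ^ a * max 1 (τ / r) ^ a := by
  rw [← Real.mul_rpow (by positivity) (by positivity)]
  refine Real.rpow_le_rpow (by positivity) ?_ ha
  rcases le_total r R with hrR | hRr
  · calc min τ R ≤ τ := min_le_left _ _
      _ = r * (τ / r) := (mul_div_cancel₀ τ hr.ne').symm
      _ ≤ min r R * max 1 (τ / r) := by
        rw [min_eq_left hrR]
        gcongr
        exact le_max_right _ _
  · rw [min_eq_right hRr]
    exact (min_le_right _ _).trans (le_mul_of_one_le_right hR.le (le_max_left _ _))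

lemma mul_min_rpow_le_of_bound {y τ r R a ε M : ℝ} (hy : 0 ≤ y) (hy_le : y ≤ 1) (hτ : 1 ≤ τ)
    (hr : 0 < r) (hR : 0 < R) (ha : 0 < a) (haε : a ≤ ε) (hM : 0 ≤ M)
    (bound : 1 ≤ r → y * min r R ^ a ≤ M) :
    y * min τ R ^ a ≤ M + (M * (a / ε) + 1) * (τ / r) ^ ε := by
  have hτ_pos : 0 < τ := one_pos.trans_le hτ
  have hε : 0 < ε := ha.trans_le haε
  rcases le_or_gt 1 r with large | small
  · calc y * min τ R ^ a ≤ y * (min r R ^ a * max 1 (τ / r) ^ a) := by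
          gcongr
          exact min_rpow_le_mul_max_rpow hτ_pos hr hR ha.le
      _ = y * min r R ^ a * max 1 (τ / r) ^ a := by ring
      _ ≤ M * (1 + a / ε * (τ / r) ^ ε) := by
          gcongr
          · exact bound large
          · exact max_one_rpow_le (by positivity) ha haε
      _ ≤ M + (M * (a / ε) + 1) * (τ / r) ^ ε := by
          linarith [Real.rpow_nonneg (div_nonneg hτ_pos.le hr.le) ε]
  · calc y * min τ R ^ a ≤ 1 * τ ^ a := by
          gcongr
          exact min_le_left _ _
      _ ≤ (τ / r) ^ a := by
          rw [one_mul]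
          gcongr
          exact le_div_self hτ_pos.le hr small.le
      _ ≤ (τ / r) ^ ε := Real.rpow_le_rpow_of_exponent_le
          (hτ.trans (le_div_self hτ_pos.le hr small.le)) haε
      _ ≤ M + (M * (a / ε) + 1) * (τ / r) ^ ε := by
          have : 0 ≤ M + M * (a / ε) * (τ / r) ^ ε := by positivity
          linarith

variable {d : ℕ} {h : (Fin d → ℝ) → ℝ} {a R : ℝ}

lemma mul_min_rpow_le_of_contracts {R₀ C δ : ℝ} (h_le_one : ∀ t, h t ≤ 1) (ha : 0 ≤ a)
    (hR : 0 < R) (hC : 0 ≤ C) (hδ : 0 < δ)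
    (contracts : ∀ M ≥ 0, (∀ t, 1 ≤ l1norm t → h t * min (l1norm t) R ^ a ≤ M) →
      ∀ t, 1 ≤ l1norm t → R₀ ≤ l1norm t → h t * min (l1norm t) R ^ a ≤ (1 - δ) * M + C) :
    ∀ t, 1 ≤ l1norm t → h t * min (l1norm t) R ^ a ≤ max (R₀ ^ a) (C / δ) := by
  have le_rpow {t : Fin d → ℝ} (ht : 1 ≤ l1norm t) {r : ℝ} (hr : min (l1norm t) R ≤ r) :
      h t * min (l1norm t) R ^ a ≤ r ^ a := by
    have min_pos : 0 < min (l1norm t) R := lt_min (one_pos.trans_le ht) hR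
    exact (mul_le_of_le_one_left (by positivity) (h_le_one t)).trans
      (Real.rpow_le_rpow min_pos.le hr ha)
  refine forall_le_of_upper_bound_improves (S := {t | 1 ≤ l1norm t})
    ⟨R ^ a, Set.forall_mem_image.2 fun t ht => le_rpow ht (min_le_right _ _)⟩ fun M hM bound => ?_
  obtain ⟨hR₀M, hCM⟩ := max_lt_iff.1 hM
  refine ⟨max (R₀ ^ a) ((1 - δ) * M + C), max_lt hR₀M ?_, fun t ht => ?_⟩
  · linarith [(div_lt_iff₀ hδ).1 hCM]
  rcases le_total (l1norm t) R₀ with near | far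
  · exact le_max_of_le_left (le_rpow ht ((min_le_left _ _).trans near))
  · exact le_max_of_le_right (contracts M ((by positivity : 0 ≤ C / δ).trans hCM.le) bound t ht far)

lemma le_max_mul_rpow_neg_of_mul_min_rpow_le {B : ℝ} (h_le_one : ∀ t, h t ≤ 1) (ha : 0 ≤ a)
    (bound : ∀ R > 0, ∀ t, 1 ≤ l1norm t → h t * min (l1norm t) R ^ a ≤ B) {t : Fin d → ℝ}
    (ht : t ≠ 0) : h t ≤ max B 1 * l1norm t ^ (-a) := by
  have t_pos := l1norm_pos ht
  rcases le_total 1 (l1norm t) with large | small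
  · have le_B := bound (l1norm t) t_pos t large
    rw [min_self] at le_B
    rw [Real.rpow_neg t_pos.le, ← div_eq_mul_inv, le_div_iff₀ (by positivity)]
    exact le_B.trans (le_max_left _ _)
  · calc h t ≤ 1 * 1 := (h_le_one t).trans_eq (one_mul 1).symm
      _ ≤ max B 1 * l1norm t ^ (-a) := by
        gcongr
        · exact le_max_right _ _
        · exact Real.one_le_rpow_of_pos_of_le_one_of_nonpos t_pos small (by linarith)

end Truncation

section Decay

variable {Ω : Type*} {d : ℕ} {N : Ω → ℕ} {A : ℕ → Ω → Matrix (Fin d) (Fin d) ℝ}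
  {η : Measure (Fin d → ℝ)} [IsProbabilityMeasure η]

lemma exists_ne_of_mem_twoLarge {t : Fin d → ℝ} {ω : Ω} (hω : ω ∈ twoLarge A t) (j : ℕ) :
    ∃ k ≠ j, 1 ≤ l1norm ((A k ω)ᵀ *ᵥ t) := by
  obtain ⟨i, i', hne, hi, hi'⟩ := hω
  by_cases hij : i = j
  · exact ⟨i', fun hi'j => hne (hij.trans hi'j.symm), hi'⟩
  · exact ⟨i, hij, hi⟩

lemma prod_norm_chf_le {l : ℝ} (hl : ∀ t, 1 ≤ l1norm t → ‖chf η t‖ ≤ l) {t : Fin d → ℝ} {ω : Ω}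
    {j : ℕ} (hj : j < N ω) (hzero : ∀ i, N ω ≤ i → A i ω = 0) :
    ∏ i ∈ Finset.range (N ω), ‖chf η ((A i ω)ᵀ *ᵥ t)‖ ≤
      ‖chf η ((A j ω)ᵀ *ᵥ t)‖ * (1 - (twoLarge A t).indicator (fun _ => 1 - l) ω) := by
  rw [← Finset.mul_prod_erase _ _ (Finset.mem_range.2 hj)]
  refine mul_le_mul_of_nonneg_left ?_ (norm_nonneg _)
  by_cases hω : ω ∈ twoLarge A t
  · obtain ⟨k, hkj, hk⟩ := exists_ne_of_mem_twoLarge hω j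
    have hkN : k < N ω := lt_of_transpose_mulVec_ne_zero hzero (ne_zero_of_one_le_l1norm hk)
    rw [Set.indicator_of_mem hω, sub_sub_cancel, ← Finset.mul_prod_erase _ _
      (Finset.mem_erase.2 ⟨hkj, Finset.mem_range.2 hkN⟩)]
    exact (mul_le_of_le_one_right (norm_nonneg _) (Finset.prod_le_one (fun _ _ => norm_nonneg _)
      fun _ _ => norm_chf_le_one η _)).trans (hl _ hk)
  · rw [Set.indicator_of_notMem hω, sub_zero]
    exact Finset.prod_le_one (fun _ _ => norm_nonneg _) fun _ _ => norm_chf_le_one η _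

/-- A large child other than `A_jᵀ t` contributes a factor at most `l`. -/
lemma prod_norm_chf_mul_min_rpow_le {l a ε R M : ℝ} (hl : ∀ t, 1 ≤ l1norm t → ‖chf η t‖ ≤ l)
    (hl_le : l ≤ 1) (hl_nonneg : 0 ≤ l) (ha : 0 < a) (haε : a ≤ ε) (hR : 0 < R) (hM : 0 ≤ M)
    (bound : ∀ t, 1 ≤ l1norm t → ‖chf η t‖ * min (l1norm t) R ^ a ≤ M) {t : Fin d → ℝ}
    (ht : 1 ≤ l1norm t) {ω : Ω} {j : ℕ} (hj : j < N ω) (hzero : ∀ i, N ω ≤ i → A i ω = 0)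
    (hAj : (A j ω)ᵀ *ᵥ t ≠ 0) :
    (∏ i ∈ Finset.range (N ω), ‖chf η ((A i ω)ᵀ *ᵥ t)‖) * min (l1norm t) R ^ a ≤
      M * (1 - (twoLarge A t).indicator (fun _ => 1 - l) ω) +
        (M * (a / ε) + 1) * l1norm t ^ ε * l1norm ((A j ω)ᵀ *ᵥ t) ^ (-ε) := by
  set T := (A j ω)ᵀ *ᵥ t
  set loss := (twoLarge A t).indicator (fun _ => 1 - l) ω
  have t_pos : 0 < l1norm t := one_pos.trans_le ht
  have T_pos : 0 < l1norm T := l1norm_pos hAj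
  have hε : 0 < ε := ha.trans_le haε
  have loss_nonneg : 0 ≤ loss := Set.indicator_nonneg (fun _ _ => by linarith) ω
  have loss_le_one : loss ≤ 1 :=
    (Set.indicator_le_self' (fun _ _ => by linarith) ω).trans (by linarith)
  have : 0 ≤ 1 - loss := sub_nonneg.2 loss_le_one
  calc (∏ i ∈ Finset.range (N ω), ‖chf η ((A i ω)ᵀ *ᵥ t)‖) * min (l1norm t) R ^ a
      ≤ ‖chf η T‖ * (1 - loss) * min (l1norm t) R ^ a := by
        gcongr
        exact prod_norm_chf_le hl hj hzero
    _ = (‖chf η T‖ * min (l1norm t) R ^ a) * (1 - loss) := by ring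
    _ ≤ (M + (M * (a / ε) + 1) * (l1norm t / l1norm T) ^ ε) * (1 - loss) := by
        gcongr
        exact mul_min_rpow_le_of_bound (norm_nonneg _) (norm_chf_le_one η _) ht T_pos hR ha haε hM
          (bound T)
    _ ≤ M * (1 - loss) + (M * (a / ε) + 1) * (l1norm t / l1norm T) ^ ε := by
        rw [add_mul]
        exact add_le_add_right
          (mul_le_of_le_one_right (by positivity) (sub_le_self 1 loss_nonneg)) _
    _ = M * (1 - loss) + (M * (a / ε) + 1) * l1norm t ^ ε * l1norm T ^ (-ε) := by
        rw [Real.div_rpow t_pos.le T_pos.le, Real.rpow_neg T_pos.le]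
        ring

variable [MeasurableSpace Ω] {P : Measure Ω} [IsProbabilityMeasure P]

lemma integral_one_sub_indicator_le {E : Set Ω} (hE : MeasurableSet E) {b p : ℝ} (hb : 0 ≤ b)
    (hp : p ≤ P.real E) : ∫ ω, (1 - E.indicator (fun _ => b) ω) ∂P ≤ 1 - b * p := by
  rw [integral_sub (integrable_const _) ((integrable_const _).indicator hE),
    integral_indicator_const _ hE, integral_const, probReal_univ, one_smul, smul_eq_mul, mul_comm b]
  gcongr

lemma norm_chf_mul_min_rpow_le (hN : Measurable N) (hA : ∀ i, Measurable (A i))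
    (hzero : ∀ᵐ ω ∂P, ∀ i, N ω ≤ i → A i ω = 0) (hη : smoothingTransform P N A η = η)
    {w : (Fin d → ℝ) → ℝ} {ρ ε C l p a R M : ℝ} (hl : ∀ t, 1 ≤ l1norm t → ‖chf η t‖ ≤ l)
    (hl_le : l ≤ 1) (hl_nonneg : 0 ≤ l) (ha : 0 < a) (haε : a ≤ ε) (hR : 0 < R) (hM : 0 ≤ M)
    (bound : ∀ t, 1 ≤ l1norm t → ‖chf η t‖ * min (l1norm t) R ^ a ≤ M)
    {t : Fin d → ℝ} (ht : 1 ≤ l1norm t) (hp : p ≤ P.real (twoLarge A t))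
    {j : Ω → ℕ} (hj : ∀ᵐ ω ∂P, j ω < N ω)
    (hT : ChildStep P (fun t => ‖chf η t‖) w ρ ε C t fun ω => (A (j ω) ω)ᵀ *ᵥ t) :
    ‖chf η t‖ * min (l1norm t) R ^ a ≤ (1 - (1 - l) * p + a / ε * C) * M + C := by
  set loss : Ω → ℝ := (twoLarge A t).indicator fun _ => 1 - l
  set X : Ω → ℝ := fun ω => l1norm ((A (j ω) ω)ᵀ *ᵥ t) ^ (-ε)
  set D := (M * (a / ε) + 1) * l1norm t ^ ε with hD
  have t_pos : 0 < l1norm t := one_pos.trans_le ht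
  have hε : 0 < ε := ha.trans_le haε
  have integrable_loss : Integrable (fun ω => M * (1 - loss ω)) P :=
    ((integrable_const _).sub
      ((integrable_const _).indicator (measurableSet_twoLarge hA t))).const_mul M
  have integrable_rpow : Integrable (fun ω => D * X ω) P := hT.integrable_rpow.const_mul D
  calc ‖chf η t‖ * min (l1norm t) R ^ a
      ≤ (∫ ω, ∏ i ∈ Finset.range (N ω), ‖chf η ((A i ω)ᵀ *ᵥ t)‖ ∂P) * min (l1norm t) R ^ a := by
        gcongr
        exact norm_chf_le_integral_prod hN hA hη t
    _ ≤ ∫ ω, (M * (1 - loss ω) + D * X ω) ∂P := by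
        rw [← integral_mul_const]
        refine integral_mono_of_nonneg (ae_of_all _ fun ω => by positivity)
          (integrable_loss.add integrable_rpow) ?_
        filter_upwards [hj, hT.ne_zero, hzero] with ω hjω hTω hzeroω
        exact prod_norm_chf_mul_min_rpow_le hl hl_le hl_nonneg ha haε hR hM bound ht hjω hzeroω hTω
    _ = M * ∫ ω, (1 - loss ω) ∂P + D * ∫ ω, X ω ∂P := by
        rw [integral_add integrable_loss integrable_rpow, integral_const_mul, integral_const_mul]
    _ ≤ M * (1 - (1 - l) * p) + D * (C * l1norm t ^ (-ε)) := by
        gcongr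
        · exact integral_one_sub_indicator_le (measurableSet_twoLarge hA t) (sub_nonneg.2 hl_le) hp
        · exact hT.integral_rpow_le
    _ = (1 - (1 - l) * p + a / ε * C) * M + C := by
        rw [hD, Real.rpow_neg t_pos.le]
        field_simp
        ring

lemma exists_norm_chf_le_mul_rpow_neg (hN : Measurable N) (hA : ∀ i, Measurable (A i))
    (hzero : ∀ᵐ ω ∂P, ∀ i, N ω ≤ i → A i ω = 0) (h_active : ActivityCondition P A)
    (hη : smoothingTransform P N A η = η) {s ρ K : ℝ} {w : (Fin d → ℝ) → ℝ}
    (hw : IsLyapunov P N A s ρ K w)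
    (h_nondeg : ∀ t : Fin d → ℝ, t ≠ 0 → ∀ c : ℝ, ¬ ∀ᵐ x ∂η, t ⬝ᵥ x = c) :
    ∃ a C : ℝ, 0 < a ∧ 0 < C ∧ ∀ t ≠ 0, ‖chf η t‖ ≤ C * l1norm t ^ (-a) := by
  obtain ⟨ε, C, hε, hC, hchild⟩ := exists_childStep hN hA hzero h_active hη hw
  have hstep : ∀ t ≠ 0, ∃ T, ChildStep P (fun t => ‖chf η t‖) w ρ ε C t T := fun t ht => by
    obtain ⟨j, -, hT⟩ := hchild t ht
    exact ⟨_, hT⟩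
  obtain ⟨l', hl', chf_le⟩ := exists_gap hw.exponent_pos hε hw.rate_lt_one hw.rpow_le
    hw.le_mul_rpow (continuous_chf η).norm (fun _ => norm_nonneg _) (norm_chf_le_one η)
    (fun _ => norm_chf_lt_one hw.exponent_pos hw.rate_pos.le hw.rate_lt_one hw.rpow_le hstep
      h_nondeg) hstep
  obtain ⟨p, R₀, hp, hR₀⟩ := h_active.exists_le_measureReal_twoLarge
  set l := max l' 0
  have hl : l < 1 := max_lt hl' one_pos
  set δ := (1 - l) * p / 2
  have hδ : 0 < δ := half_pos (mul_pos (sub_pos.2 hl) hp)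
  set a := min ε (δ * ε / C)
  have ha : 0 < a := by positivity
  have a_small : a / ε * C ≤ δ :=
    calc a / ε * C ≤ (δ * ε / C) / ε * C := by gcongr; exact min_le_right _ _
      _ = δ := by field_simp
  refine ⟨a, max (max (R₀ ^ a) (C / δ)) 1, ha, by positivity, fun t ht =>
    le_max_mul_rpow_neg_of_mul_min_rpow_le (h := fun t => ‖chf η t‖) (norm_chf_le_one η) ha.le
      (fun R hR => mul_min_rpow_le_of_contracts (norm_chf_le_one η) ha.le hR
        hC.le hδ fun M hM bound t ht ht_far => ?_) ht⟩
  obtain ⟨j, hj, hT⟩ := hchild t (ne_zero_of_one_le_l1norm ht)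
  calc ‖chf η t‖ * min (l1norm t) R ^ a ≤ (1 - (1 - l) * p + a / ε * C) * M + C :=
        norm_chf_mul_min_rpow_le hN hA hzero hη
          (fun t ht => (chf_le t ht).trans (le_max_left l' 0)) hl.le (le_max_right l' 0) ha
          (min_le_left _ _) hR hM bound ht (hR₀ t ht_far) hj hT
    _ ≤ (1 - (1 - l) * p + δ) * M + C := by gcongr
    _ = (1 - δ) * M + C := by ring

end Decay

/-! ### Integrable characteristic functions -/

section FourierInversion

open FourierTransform SchwartzMap ContDiff

variable {E : Type*} [NormedAddCommGroup E] [InnerProductSpace ℝ E]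

lemma exists_contDiff_between_indicators [FiniteDimensional ℝ E] {K U : Set E} (hK : IsCompact K)
    (hU : IsOpen U) (hKU : K ⊆ U) :
    ∃ g : E → ℝ, ContDiff ℝ ∞ g ∧ HasCompactSupport g ∧
      K.indicator 1 ≤ g ∧ g ≤ U.indicator 1 := by
  obtain ⟨W, hW, hKW, hWU, hW_compact⟩ := exists_open_between_and_isCompact_closure hK hU hKU
  obtain ⟨g, hg, g_range, g_support, g_eq_one⟩ :=
    exists_contMDiff_support_eq_eq_one_iff (modelWithCornersSelf ℝ E) hW hK.isClosed hKW
  refine ⟨g, hg.contDiff, .of_support_subset_isCompact hW_compact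
    (g_support.trans_subset subset_closure), fun x => ?_, fun x => ?_⟩
  · by_cases hx : x ∈ K
    · rw [Set.indicator_of_mem hx, (g_eq_one x).1 hx, Pi.one_apply]
    · rw [Set.indicator_of_notMem hx]
      exact (g_range ⟨x, rfl⟩).1
  · by_cases hx : x ∈ U
    · rw [Set.indicator_of_mem hx]
      exact (g_range ⟨x, rfl⟩).2
    · rw [Set.indicator_of_notMem hx]
      exact (Function.notMem_support.1 fun hxg =>
        hx (hWU (subset_closure (g_support.subset hxg)))).le

variable [MeasurableSpace E]

lemma fourierIntegral_one_eq_charFun (ν : Measure E) (ξ : E) :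
    VectorFourier.fourierIntegral Real.fourierChar ν (innerₗ E) 1 ξ =
      charFun ν (-(2 * Real.pi) • ξ) := by
  rw [charFun_eq_fourierIntegral', smul_smul, neg_mul_neg,
    inv_mul_cancel₀ Real.two_pi_pos.ne', one_smul]

variable [FiniteDimensional ℝ E] [BorelSpace E] (ν : Measure E) [IsFiniteMeasure ν]

lemma integral_schwartz_eq (f : 𝓢(E, ℂ)) :
    ∫ x, f x ∂ν = ∫ ξ, charFun ν (-(2 * Real.pi) • ξ) * (𝓕⁻ f) ξ := by
  have fourier_inversion (x : E) :
      VectorFourier.fourierIntegral Real.fourierChar volume (innerₗ E).flip (𝓕⁻ f : 𝓢(E, ℂ)) x =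
        f x := by
    rw [flip_innerₗ]
    exact (congrFun (SchwartzMap.fourier_coe _) x).symm.trans
      (DFunLike.congr_fun (FourierTransform.fourier_fourierInv_eq f) x)
  have parseval := VectorFourier.integral_fourierIntegral_smul_eq_flip (μ := ν) (ν := volume)
    (f := 1) (g := (𝓕⁻ f : 𝓢(E, ℂ))) (L := innerₗ E) Real.continuous_fourierChar
    (by simpa using continuous_inner) (integrable_const (1 : ℂ)) (𝓕⁻ f).integrable
  simpa only [fourierIntegral_one_eq_charFun, fourier_inversion, smul_eq_mul, Pi.one_apply,
    one_mul] using parseval.symm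

lemma norm_integral_schwartz_le (hν : Integrable (charFun ν)) (f : 𝓢(E, ℂ)) :
    ‖∫ x, f x ∂ν‖ ≤ (∫ ξ, ‖charFun ν (-(2 * Real.pi) • ξ)‖) * ∫ x, ‖f x‖ := by
  have integrable_dilation : Integrable fun ξ : E => ‖charFun ν (-(2 * Real.pi) • ξ)‖ :=
    (hν.comp_smul (neg_ne_zero.2 Real.two_pi_pos.ne')).norm
  rw [integral_schwartz_eq, ← integral_mul_const]
  refine norm_integral_le_of_norm_le (integrable_dilation.mul_const _) (ae_of_all _ fun ξ => ?_)
  rw [norm_mul]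
  gcongr
  rw [SchwartzMap.fourierInv_coe, Real.fourierInv_eq_fourier_neg]
  exact VectorFourier.norm_fourierIntegral_le_integral_norm _ _ _ _ _

lemma integral_le_of_integrable_charFun (hν : Integrable (charFun ν)) {g : E → ℝ}
    (hg : ContDiff ℝ ∞ g) (hg_supp : HasCompactSupport g) (hg_nonneg : 0 ≤ g) :
    ∫ x, g x ∂ν ≤ (∫ ξ, ‖charFun ν (-(2 * Real.pi) • ξ)‖) * ∫ x, g x := by
  let f : 𝓢(E, ℂ) := (hg_supp.comp_left Complex.ofReal_zero).toSchwartzMap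
    (Complex.ofRealCLM.contDiff.comp hg)
  have f_apply (x : E) : f x = (g x : ℂ) := rfl
  have norm_f (x : E) : ‖f x‖ = g x := by
    rw [f_apply, Complex.norm_real, Real.norm_of_nonneg (hg_nonneg x)]
  have := norm_integral_schwartz_le ν hν f
  simp only [norm_f] at this
  rwa [integral_congr_ae (ae_of_all _ f_apply), integral_complex_ofReal, Complex.norm_real,
    Real.norm_of_nonneg (integral_nonneg hg_nonneg)] at this

lemma measure_compact_le_of_integrable_charFun (hν : Integrable (charFun ν)) {K U : Set E}
    (hK : IsCompact K) (hU : IsOpen U) (hKU : K ⊆ U) :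
    ν K ≤ ENNReal.ofReal (∫ ξ, ‖charFun ν (-(2 * Real.pi) • ξ)‖) * volume U := by
  obtain ⟨g, hg, hg_supp, K_le_g, g_le_U⟩ := exists_contDiff_between_indicators hK hU hKU
  have hg_nonneg : 0 ≤ g := fun x =>
    (Set.indicator_nonneg (fun _ _ => zero_le_one) x).trans (K_le_g x)
  have ofReal_integral (m : Measure E) [IsFiniteMeasureOnCompacts m] :
      ENNReal.ofReal (∫ x, g x ∂m) = ∫⁻ x, ENNReal.ofReal (g x) ∂m :=
    ofReal_integral_eq_lintegral_ofReal (hg.continuous.integrable_of_hasCompactSupport hg_supp)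
      (ae_of_all _ hg_nonneg)
  have ofReal_indicator (S : Set E) (x : E) :
      ENNReal.ofReal (S.indicator 1 x) = S.indicator 1 x := by
    by_cases hx : x ∈ S <;> simp [hx]
  calc ν K = ∫⁻ x, K.indicator 1 x ∂ν := (lintegral_indicator_one hK.measurableSet).symm
    _ ≤ ∫⁻ x, ENNReal.ofReal (g x) ∂ν := lintegral_mono fun x =>
      (ofReal_indicator K x).symm.trans_le (ENNReal.ofReal_le_ofReal (K_le_g x))
    _ = ENNReal.ofReal (∫ x, g x ∂ν) := (ofReal_integral ν).symm
    _ ≤ ENNReal.ofReal ((∫ ξ, ‖charFun ν (-(2 * Real.pi) • ξ)‖) * ∫ x, g x) :=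
      ENNReal.ofReal_le_ofReal (integral_le_of_integrable_charFun ν hν hg hg_supp hg_nonneg)
    _ = ENNReal.ofReal (∫ ξ, ‖charFun ν (-(2 * Real.pi) • ξ)‖) * ∫⁻ x, ENNReal.ofReal (g x) := by
      rw [ENNReal.ofReal_mul (integral_nonneg fun _ => norm_nonneg _), ofReal_integral volume]
    _ ≤ ENNReal.ofReal (∫ ξ, ‖charFun ν (-(2 * Real.pi) • ξ)‖) * volume U := by
      rw [← lintegral_indicator_one hU.measurableSet]
      gcongr with x
      exact (ENNReal.ofReal_le_ofReal (g_le_U x)).trans_eq (ofReal_indicator U x)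

lemma le_smul_volume_of_integrable_charFun (hν : Integrable (charFun ν)) :
    ν ≤ ENNReal.ofReal (∫ ξ, ‖charFun ν (-(2 * Real.pi) • ξ)‖) • volume := by
  refine Measure.le_iff.2 fun S hS => ?_
  rw [hS.measure_eq_iSup_isCompact]
  refine iSup₂_le fun K hKS => iSup_le fun hK => ?_
  calc ν K ≤ ⨅ (U : Set E) (_ : K ⊆ U) (_ : IsOpen U),
        (ENNReal.ofReal (∫ ξ, ‖charFun ν (-(2 * Real.pi) • ξ)‖) • (volume : Measure E)) U :=
        le_iInf₂ fun U hKU => le_iInf fun hU =>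
          measure_compact_le_of_integrable_charFun ν hν hK hU hKU
    _ = (ENNReal.ofReal (∫ ξ, ‖charFun ν (-(2 * Real.pi) • ξ)‖) • (volume : Measure E)) K :=
        have := Measure.OuterRegular.smul (volume : Measure E)
          (ENNReal.ofReal_ne_top (r := ∫ ξ, ‖charFun ν (-(2 * Real.pi) • ξ)‖))
        (K.measure_eq_iInf_isOpen _).symm
    _ ≤ _ := measure_mono hKS

lemma absolutelyContinuous_of_integrable_charFun (hν : Integrable (charFun ν)) : ν ≪ volume :=
  Measure.absolutelyContinuous_of_le_smul (le_smul_volume_of_integrable_charFun ν hν)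

end FourierInversion

/-! ### Convolution with a law carried by a subspace -/

section Slices

variable {E : Type*} [NormedAddCommGroup E] [InnerProductSpace ℝ E] [FiniteDimensional ℝ E]
  (V : Submodule ℝ E)

lemma add_coe_eq_orthogonalProjectionOnto_add (y : E) (v : V) :
    y + v = (Vᗮ.orthogonalProjectionOnto y : E) + (V.orthogonalProjectionOnto y + v : V) := by
  have decomposition := V.starProjection_add_starProjection_orthogonal y
  simp only [Submodule.starProjection_apply] at decomposition
  nth_rewrite 1 [← decomposition]
  rw [Submodule.coe_add]
  abel

variable [MeasurableSpace E] [BorelSpace E]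

lemma ae_slice_null {S : Set E} (hS : MeasurableSet S)
    (hS_null : (Measure.addHaar : Measure E) S = 0) :
    ∀ᵐ y : Vᗮ ∂Measure.addHaar, (Measure.addHaar : Measure V) {v | (y : E) + v ∈ S} = 0 := by
  let L : (Vᗮ × V) ≃L[ℝ] E :=
    (Submodule.prodEquivOfIsCompl Vᗮ V V.isCompl_orthogonal.symm).toContinuousLinearEquiv
  let m : Measure (Vᗮ × V) := (Measure.addHaar : Measure Vᗮ).prod (Measure.addHaar : Measure V)
  have : (m.map L).IsAddHaarMeasure := L.isAddHaarMeasure_map m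
  have map_null : (m.map L) S = 0 :=
    Measure.absolutelyContinuous_isAddHaarMeasure (m.map L) Measure.addHaar hS_null
  rwa [Measure.map_apply L.continuous.measurable hS,
    Measure.measure_prod_null (L.continuous.measurable hS)] at map_null

lemma conv_absolutelyContinuous_of_projection {ν₁ : Measure V} [SFinite ν₁]
    (hν₁ : ν₁ ≪ Measure.addHaar) {ν₂ : Measure E} [SFinite ν₂]
    (hν₂ : ν₂.map Vᗮ.orthogonalProjectionOnto ≪ Measure.addHaar) :
    (ν₁.map V.subtypeL) ∗ ν₂ ≪ Measure.addHaar := by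
  refine Measure.AbsolutelyContinuous.mk fun S hS hS_null => ?_
  have measurable_slice (y : E) : Measurable fun v : V => y + V.subtypeL v :=
    (measurable_const_add y).comp V.subtypeL.continuous.measurable
  have slice_null : ∀ᵐ y ∂ν₂, ν₁ ((fun v : V => y + V.subtypeL v) ⁻¹' S) = 0 := by
    filter_upwards [ae_of_ae_map (by fun_prop) (hν₂.ae_le (ae_slice_null V hS hS_null))] with y hy
    refine hν₁ ?_
    have slice_eq : (fun v : V => y + V.subtypeL v) ⁻¹' S =
        (fun v => V.orthogonalProjectionOnto y + v) ⁻¹'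
          {v : V | (Vᗮ.orthogonalProjectionOnto y : E) + v ∈ S} := by
      ext v
      rw [Set.mem_preimage, Submodule.subtypeL_apply, add_coe_eq_orthogonalProjectionOnto_add]
      rfl
    rw [slice_eq, measure_preimage_add, hy]
  rw [Measure.conv_comm, ← lintegral_indicator_one hS,
    Measure.lintegral_conv (measurable_one.indicator hS)]
  refine (lintegral_congr_ae (g := 0) ?_).trans lintegral_zero
  filter_upwards [slice_null] with y hy
  rw [lintegral_map (by exact (measurable_one.indicator hS).comp (measurable_const_add y))
    V.subtypeL.continuous.measurable]
  exact (lintegral_indicator_one (measurable_slice y hS)).trans hy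

end Slices

/-! ### Sums of surjective linear images -/

section DotAdjoint

variable {d : ℕ} {E : Type*} [NormedAddCommGroup E] [InnerProductSpace ℝ E]

/-- The adjoint of `C : ℝ^d → E` for the dot product on `ℝ^d`; it turns characteristic functions on
`E` into characteristic functions on `ℝ^d`. -/
def dotAdjoint (C : (Fin d → ℝ) →L[ℝ] E) : E →ₗ[ℝ] (Fin d → ℝ) :=
  LinearMap.pi fun k => innerₗ E (C (Pi.single k 1))

lemma dotAdjoint_apply (C : (Fin d → ℝ) →L[ℝ] E) (ξ : E) (k : Fin d) :
    dotAdjoint C ξ k = inner ℝ (C (Pi.single k 1)) ξ := rfl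

lemma dotAdjoint_dotProduct (C : (Fin d → ℝ) →L[ℝ] E) (ξ : E) (x : Fin d → ℝ) :
    dotAdjoint C ξ ⬝ᵥ x = inner ℝ (C x) ξ := by
  conv_rhs => rw [pi_eq_sum_univ' x]
  simp only [map_sum, map_smul, sum_inner, real_inner_smul_left, dotProduct, dotAdjoint_apply,
    mul_comm]

lemma dotAdjoint_zero (ξ : E) : dotAdjoint (0 : (Fin d → ℝ) →L[ℝ] E) ξ = 0 := by
  ext k
  simp [dotAdjoint_apply]

lemma dotAdjoint_comp_matCLM (C : (Fin d → ℝ) →L[ℝ] E) (a : Matrix (Fin d) (Fin d) ℝ) (ξ : E) :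
    dotAdjoint (C.comp (matCLM a)) ξ = aᵀ *ᵥ dotAdjoint C ξ := by
  refine dotProduct_eq _ _ fun x => ?_
  rw [dotAdjoint_dotProduct, Matrix.mulVec_transpose, ← Matrix.dotProduct_mulVec,
    dotAdjoint_dotProduct]
  rfl

lemma dotAdjoint_ne_zero {C : (Fin d → ℝ) →L[ℝ] E} (hC : Function.Surjective C) {ξ : E}
    (hξ : ξ ≠ 0) : dotAdjoint C ξ ≠ 0 := fun dotAdjoint_eq_zero => by
  obtain ⟨x, rfl⟩ := hC ξ
  refine hξ (inner_self_eq_zero (𝕜 := ℝ).1 ?_)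
  rw [← dotAdjoint_dotProduct, dotAdjoint_eq_zero, zero_dotProduct]

lemma exists_norm_le_mul_l1norm_dotAdjoint [FiniteDimensional ℝ E] {C : (Fin d → ℝ) →L[ℝ] E}
    (hC : Function.Surjective C) :
    ∃ κ : ℝ, 0 ≤ κ ∧ ∀ ξ, ‖ξ‖ ≤ κ * l1norm (dotAdjoint C ξ) := by
  obtain ⟨κ, -, antilipschitz⟩ := (dotAdjoint C).exists_antilipschitzWith <|
    LinearMap.ker_eq_bot'.2 fun ξ => not_imp_not.1 (dotAdjoint_ne_zero hC)
  refine ⟨κ, κ.2, fun ξ => ?_⟩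
  calc ‖ξ‖ ≤ κ * ‖dotAdjoint C ξ‖ := by
        simpa only [dist_zero_right, map_zero] using antilipschitz.le_mul_dist ξ 0
    _ ≤ κ * l1norm (dotAdjoint C ξ) := by
        gcongr
        exact (pi_norm_le_iff_of_nonneg (l1norm_nonneg _)).2 fun i => abs_apply_le_l1norm _ i

end DotAdjoint

section FullRank

variable {d : ℕ} {E : Type*} [NormedAddCommGroup E] [InnerProductSpace ℝ E]
  {η : Measure (Fin d → ℝ)} [IsProbabilityMeasure η] {a C : ℝ}

lemma norm_chf_le_mul_max_rpow_neg (h_decay : ∀ t ≠ 0, ‖chf η t‖ ≤ C * l1norm t ^ (-a))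
    (t : Fin d → ℝ) : ‖chf η t‖ ≤ max 1 C * max 1 (l1norm t) ^ (-a) := by
  rcases le_total (l1norm t) 1 with ht | ht
  · rw [max_eq_left ht, Real.one_rpow, mul_one]
    exact (norm_chf_le_one η t).trans (le_max_left _ _)
  · rw [max_eq_right ht]
    refine (h_decay t (ne_zero_of_one_le_l1norm ht)).trans ?_
    have := l1norm_nonneg t
    gcongr
    exact le_max_right _ _

variable [FiniteDimensional ℝ E]

lemma exists_norm_chf_dotAdjoint_le (ha : 0 ≤ a)
    (h_decay : ∀ t ≠ 0, ‖chf η t‖ ≤ C * l1norm t ^ (-a)) {D : (Fin d → ℝ) →L[ℝ] E}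
    (hD : Function.Surjective D) :
    ∃ B : ℝ, 0 ≤ B ∧ ∀ ξ, ‖chf η (dotAdjoint D ξ)‖ ≤ B * (1 + ‖ξ‖) ^ (-a) := by
  obtain ⟨κ, hκ, norm_le⟩ := exists_norm_le_mul_l1norm_dotAdjoint hD
  refine ⟨max 1 C * (1 + κ) ^ a, by positivity, fun ξ => ?_⟩
  have one_add_norm_le : (1 + ‖ξ‖) / (1 + κ) ≤ max 1 (l1norm (dotAdjoint D ξ)) := by
    rw [div_le_iff₀ (by positivity)]
    nlinarith [norm_le ξ, le_max_left 1 (l1norm (dotAdjoint D ξ)),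
      mul_le_mul_of_nonneg_left (le_max_right 1 (l1norm (dotAdjoint D ξ))) hκ]
  calc ‖chf η (dotAdjoint D ξ)‖
      ≤ max 1 C * max 1 (l1norm (dotAdjoint D ξ)) ^ (-a) := norm_chf_le_mul_max_rpow_neg h_decay _
    _ ≤ max 1 C * ((1 + ‖ξ‖) / (1 + κ)) ^ (-a) := by
        refine mul_le_mul_of_nonneg_left ?_ (by positivity)
        exact Real.rpow_le_rpow_of_nonpos (by positivity) one_add_norm_le (neg_nonpos.2 ha)
    _ = max 1 C * (1 + κ) ^ a * (1 + ‖ξ‖) ^ (-a) := by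
        rw [Real.div_rpow (by positivity) (by positivity),
          Real.rpow_neg (x := 1 + κ) (by positivity), div_inv_eq_mul,
          mul_comm ((1 + ‖ξ‖) ^ (-a)), mul_assoc]

variable [MeasurableSpace E] [BorelSpace E]

lemma charFun_sumLaw (l : List ((Fin d → ℝ) →L[ℝ] E)) (ξ : E) :
    charFun (sumLaw η l) ξ = (l.map fun C => chf η (dotAdjoint C ξ)).prod := by
  rw [charFun_eq_charFunDual_toDualMap, charFunDual_sumLaw]
  congr 1
  refine List.map_congr_left fun C _ => congrArg _ (ContinuousLinearMap.ext fun x => ?_)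
  rw [dotCLM_apply, dotAdjoint_dotProduct, real_inner_comm]
  rfl

lemma exists_norm_charFun_sumLaw_le (ha : 0 ≤ a)
    (h_decay : ∀ t ≠ 0, ‖chf η t‖ ≤ C * l1norm t ^ (-a)) (l : List ((Fin d → ℝ) →L[ℝ] E))
    (hl : ∀ D ∈ l, Function.Surjective D) :
    ∃ B : ℝ, 0 ≤ B ∧ ∀ ξ, ‖charFun (sumLaw η l) ξ‖ ≤ B * (1 + ‖ξ‖) ^ (-(a * l.length)) := by
  induction l with
  | nil => exact ⟨1, zero_le_one, fun ξ => by simp [charFun_sumLaw]⟩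
  | cons D l ih =>
    obtain ⟨B, hB, norm_tail_le⟩ := ih fun D' hD' => hl D' (List.mem_cons_of_mem _ hD')
    obtain ⟨B', hB', norm_head_le⟩ := exists_norm_chf_dotAdjoint_le ha h_decay
      (hl D List.mem_cons_self)
    refine ⟨B' * B, by positivity, fun ξ => ?_⟩
    calc ‖charFun (sumLaw η (D :: l)) ξ‖
        = ‖chf η (dotAdjoint D ξ)‖ * ‖charFun (sumLaw η l) ξ‖ := by
          rw [charFun_sumLaw, List.map_cons, List.prod_cons, norm_mul, ← charFun_sumLaw]
      _ ≤ B' * (1 + ‖ξ‖) ^ (-a) * (B * (1 + ‖ξ‖) ^ (-(a * l.length))) := by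
          gcongr
          exacts [norm_head_le ξ, norm_tail_le ξ]
      _ = B' * B * (1 + ‖ξ‖) ^ (-(a * (D :: l).length)) := by
          rw [mul_mul_mul_comm, ← Real.rpow_add (by positivity), List.length_cons, Nat.cast_succ]
          ring_nf

lemma sumLaw_absolutelyContinuous_of_length (ha : 0 ≤ a)
    (h_decay : ∀ t ≠ 0, ‖chf η t‖ ≤ C * l1norm t ^ (-a)) (l : List ((Fin d → ℝ) →L[ℝ] E))
    (hl : ∀ D ∈ l, Function.Surjective D) (h_length : Module.finrank ℝ E < a * l.length) :
    sumLaw η l ≪ Measure.addHaar := by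
  obtain ⟨B, -, norm_charFun_le⟩ := exists_norm_charFun_sumLaw_le ha h_decay l hl
  have integrable_charFun : Integrable (charFun (sumLaw η l)) :=
    ((integrable_one_add_norm h_length).const_mul B).mono'
      measurable_charFun.aestronglyMeasurable (ae_of_all _ norm_charFun_le)
  exact (absolutelyContinuous_of_integrable_charFun _ integrable_charFun).trans
    (Measure.absolutelyContinuous_isAddHaarMeasure _ _)

end FullRank

/-! ### Absolute continuity by induction on the dimension -/

section Spanning

variable {V E : Type*} [NormedAddCommGroup V] [NormedSpace ℝ V] [NormedAddCommGroup E]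
  [InnerProductSpace ℝ E]

/-- The ranges of the maps in `l` span `E`, expressed by duality: only `0` is orthogonal to all of
them. -/
def Spans {V E : Type*} [NormedAddCommGroup V] [NormedSpace ℝ V] [NormedAddCommGroup E]
    [InnerProductSpace ℝ E] (l : List (V →L[ℝ] E)) : Prop :=
  ∀ ξ : E, (∀ C ∈ l, ∀ x, inner ℝ (C x) ξ = 0) → ξ = 0

lemma Spans.mono {l l' : List (V →L[ℝ] E)} (hl : Spans l) (hll' : l ⊆ l') : Spans l' :=
  fun ξ hξ => hl ξ fun C hC => hξ C (hll' hC)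

open scoped Classical in
lemma Spans.filter_ne_zero {l : List (V →L[ℝ] E)} (hl : Spans l) :
    Spans (l.filter (· ≠ 0)) := fun ξ hξ => hl ξ fun C hC x => by
  obtain rfl | hC_ne := eq_or_ne C 0
  · rw [_root_.zero_apply, inner_zero_left]
  · exact hξ C (List.mem_filter.2 ⟨hC, decide_eq_true hC_ne⟩) x

lemma spans_of_surjective {l : List (V →L[ℝ] E)} {C : V →L[ℝ] E} (hC_mem : C ∈ l)
    (hC : Function.Surjective C) : Spans l := fun ξ hξ => by
  obtain ⟨x, rfl⟩ := hC ξ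
  exact inner_self_eq_zero.1 (hξ C hC_mem x)

lemma Spans.ne_nil [Nontrivial E] {l : List (V →L[ℝ] E)} (hl : Spans l) : l ≠ [] := by
  rintro rfl
  obtain ⟨ξ, hξ⟩ := exists_ne (0 : E)
  exact hξ (hl ξ fun _ hC => absurd hC List.not_mem_nil)

open scoped Classical in
lemma Spans.map_erase_orthogonalProjectionOnto [FiniteDimensional ℝ E] {l : List (V →L[ℝ] E)}
    (hl : Spans l) (C : V →L[ℝ] E) :
    Spans ((l.erase C).map (LinearMap.range C.toLinearMap)ᗮ.orthogonalProjectionOnto.comp) := by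
  refine fun ξ hξ => Subtype.ext (hl ξ fun D hD x => ?_)
  obtain rfl | hDC := eq_or_ne D C
  · exact Submodule.inner_right_of_mem_orthogonal (LinearMap.mem_range_self D.toLinearMap x) ξ.2
  · rw [← hξ _ (List.mem_map_of_mem ((List.mem_erase_of_ne hDC).2 hD)) x]
    exact (Submodule.inner_orthogonalProjectionOnto_eq_of_mem_right ξ (D x)).symm

end Spanning

section Induction

variable {V : Type*} [NormedAddCommGroup V] [NormedSpace ℝ V] [MeasurableSpace V] [BorelSpace V]

/-- Every spanning list of linear maps into a space of dimension less than `n` has an absolutely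
continuous `sumLaw`. This is the induction hypothesis of the induction on the dimension; the target
spaces lie in `Type`, where the induction takes place. -/
def AbsContBelow {V : Type*} [NormedAddCommGroup V] [NormedSpace ℝ V] [MeasurableSpace V]
    (η : Measure V) (n : ℕ) : Prop :=
  ∀ (F : Type) [NormedAddCommGroup F] [InnerProductSpace ℝ F] [FiniteDimensional ℝ F]
    [MeasurableSpace F] [BorelSpace F], Module.finrank ℝ F < n →
    ∀ l : List (V →L[ℝ] F), Spans l → sumLaw η l ≪ Measure.addHaar

variable {η : Measure V} [IsProbabilityMeasure η]
  {E : Type} [NormedAddCommGroup E] [InnerProductSpace ℝ E] [FiniteDimensional ℝ E]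
  [MeasurableSpace E] [BorelSpace E]

lemma sumLaw_absolutelyContinuous_of_mem_of_not_surjective
    (h_below : AbsContBelow η (Module.finrank ℝ E)) {l : List (V →L[ℝ] E)} (hl : Spans l)
    {C : V →L[ℝ] E} (hC_mem : C ∈ l) (hC_ne : C ≠ 0) (hC : ¬ Function.Surjective C) :
    sumLaw η l ≪ Measure.addHaar := by
  classical
  let W : Submodule ℝ E := LinearMap.range C.toLinearMap
  let C' : V →L[ℝ] W := C.codRestrict W fun x => ⟨x, rfl⟩
  have finrank_range_lt : Module.finrank ℝ W < Module.finrank ℝ E :=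
    Submodule.finrank_lt fun range_eq_top => hC (LinearMap.range_eq_top.1 range_eq_top)
  have finrank_range_pos : 0 < Module.finrank ℝ W := by
    rw [Module.finrank_pos_iff, Submodule.nontrivial_iff_ne_bot, ne_eq, LinearMap.range_eq_bot]
    exact fun C_eq_zero => hC_ne (ContinuousLinearMap.coe_injective C_eq_zero)
  have finrank_orthogonal_lt : Module.finrank ℝ Wᗮ < Module.finrank ℝ E := by
    have := W.finrank_add_finrank_orthogonal
    omega
  have range_part : η.map C' ≪ Measure.addHaar := by
    rw [← sumLaw_singleton]
    refine h_below W finrank_range_lt [C'] (spans_of_surjective List.mem_cons_self ?_)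
    rintro ⟨_, x, rfl⟩
    exact ⟨x, rfl⟩
  have orthogonal_part :
      (sumLaw η (l.erase C)).map Wᗮ.orthogonalProjectionOnto ≪ Measure.addHaar := by
    rw [map_sumLaw]
    exact h_below Wᗮ finrank_orthogonal_lt _ (hl.map_erase_orthogonalProjectionOnto C)
  have map_eq : η.map C = (η.map C').map W.subtypeL := by
    rw [Measure.map_map W.subtypeL.continuous.measurable C'.continuous.measurable]
    rfl
  rw [sumLaw_perm η (List.perm_cons_erase hC_mem), sumLaw, map_eq]
  exact conv_absolutelyContinuous_of_projection W range_part orthogonal_part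

lemma sumLaw_absolutelyContinuous_or_forall_surjective
    (h_below : AbsContBelow η (Module.finrank ℝ E)) {l : List (V →L[ℝ] E)} (hl : Spans l) :
    sumLaw η l ≪ Measure.addHaar ∨ ∀ C ∈ l, C ≠ 0 → Function.Surjective C := by
  by_contra! h
  obtain ⟨not_ac, C, hC_mem, hC_ne, hC⟩ := h
  exact not_ac (sumLaw_absolutelyContinuous_of_mem_of_not_surjective h_below hl hC_mem hC_ne hC)

end Induction

section Children

variable {Ω : Type*} {d : ℕ} {N : Ω → ℕ} {A : ℕ → Ω → Matrix (Fin d) (Fin d) ℝ}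
  {E : Type*} [NormedAddCommGroup E] [InnerProductSpace ℝ E] {C : (Fin d → ℝ) →L[ℝ] E} {ω : Ω}

lemma spans_children (hzero : ∀ i, N ω ≤ i → A i ω = 0)
    (hactive : ∀ t : Fin d → ℝ, t ≠ 0 → 1 ≤ activeCount A t ω) (hC : Function.Surjective C) :
    Spans ((childMaps N A ω).map C.comp) := by
  intro ξ hξ
  by_contra hξ_ne
  obtain ⟨i, hi⟩ := Set.one_le_encard_iff_nonempty.1 (hactive _ (dotAdjoint_ne_zero hC hξ_ne))
  have comp_mem : C.comp (matCLM (A i ω)) ∈ (childMaps N A ω).map C.comp :=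
    List.mem_map_of_mem (List.mem_map_of_mem
      (List.mem_range.2 (lt_of_transpose_mulVec_ne_zero hzero hi)))
  refine hi ?_
  rw [← dotAdjoint_comp_matCLM]
  ext k
  exact hξ _ comp_mem _

open scoped Classical in
lemma two_le_length_filter_children (hzero : ∀ i, N ω ≤ i → A i ω = 0) {ξ : E}
    (hω : ω ∈ twoLarge A (dotAdjoint C ξ)) :
    2 ≤ (((childMaps N A ω).map C.comp).filter (· ≠ 0)).length := by
  obtain ⟨i, j, hij, hi, hj⟩ := hω
  let L := (List.range (N ω)).filter fun k => C.comp (matCLM (A k ω)) ≠ 0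
  have mem_of_one_le (k : ℕ) (hk : 1 ≤ l1norm ((A k ω)ᵀ *ᵥ dotAdjoint C ξ)) : k ∈ L.toFinset := by
    have image_ne := ne_zero_of_one_le_l1norm hk
    refine List.mem_toFinset.2 (List.mem_filter.2 ⟨List.mem_range.2
      (lt_of_transpose_mulVec_ne_zero hzero image_ne), decide_eq_true fun comp_eq_zero => ?_⟩)
    rw [← dotAdjoint_comp_matCLM, comp_eq_zero, dotAdjoint_zero] at image_ne
    exact image_ne rfl
  calc 2 ≤ L.toFinset.card :=
        Finset.one_lt_card.2 ⟨i, mem_of_one_le i hi, j, mem_of_one_le j hj, hij⟩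
    _ ≤ L.length := L.toFinset_card_le
    _ = (((childMaps N A ω).map C.comp).filter (· ≠ 0)).length := by
        rw [childMaps, List.map_map, List.filter_map, List.length_map]
        rfl

lemma exists_le_l1norm_dotAdjoint [Nontrivial E] (hC : Function.Surjective C) (R : ℝ) :
    ∃ ξ, R ≤ l1norm (dotAdjoint C ξ) := by
  obtain ⟨ξ, hξ⟩ := exists_ne (0 : E)
  have norm_pos := l1norm_pos (dotAdjoint_ne_zero hC hξ)
  refine ⟨(R / l1norm (dotAdjoint C ξ)) • ξ, ?_⟩
  rw [map_smul, l1norm_smul, abs_div, abs_of_pos norm_pos, div_mul_cancel₀ _ norm_pos.ne']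
  exact le_abs_self R

end Children

section SingularMass

variable {V : Type*} [NormedAddCommGroup V] [NormedSpace ℝ V] [MeasurableSpace V] [BorelSpace V]
  {η : Measure V} [IsProbabilityMeasure η]
  {E : Type} [NormedAddCommGroup E] [InnerProductSpace ℝ E] [FiniteDimensional ℝ E]
  [MeasurableSpace E] [BorelSpace E]

/-- The largest mass that `sumLaw η l` gives to a Lebesgue null set, over all lists `l` of `k`
surjective maps onto `E`. -/
def singularMass {V : Type*} [NormedAddCommGroup V] [NormedSpace ℝ V] [MeasurableSpace V]
    (E : Type*) [NormedAddCommGroup E] [InnerProductSpace ℝ E] [FiniteDimensional ℝ E]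
    [MeasurableSpace E] [BorelSpace E] (η : Measure V) (k : ℕ) : ℝ≥0∞ :=
  ⨆ (l : {l : List (V →L[ℝ] E) // (∀ D ∈ l, Function.Surjective D) ∧ l.length = k})
    (S : {S : Set E // MeasurableSet S ∧ (Measure.addHaar : Measure E) S = 0}), sumLaw η l.1 S.1

omit [BorelSpace V] [IsProbabilityMeasure η] in
lemma sumLaw_le_singularMass {k : ℕ} {l : List (V →L[ℝ] E)} (hl : ∀ D ∈ l, Function.Surjective D)
    (hlk : l.length = k) {S : Set E} (hS : MeasurableSet S)
    (hS_null : (Measure.addHaar : Measure E) S = 0) : sumLaw η l S ≤ singularMass E η k :=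
  le_iSup₂_of_le ⟨l, hl, hlk⟩ ⟨S, hS, hS_null⟩ le_rfl

lemma singularMass_le_one (k : ℕ) : singularMass E η k ≤ 1 :=
  iSup₂_le fun _ _ => prob_le_one

open scoped Classical in
lemma sumLaw_append_absolutelyContinuous_or_exists
    (h_below : AbsContBelow η (Module.finrank ℝ E)) {m l : List (V →L[ℝ] E)} (hm : Spans m)
    (hl : ∀ D ∈ l, Function.Surjective D) :
    sumLaw η (m ++ l) ≪ Measure.addHaar ∨
      ∃ l' : List (V →L[ℝ] E), (∀ D ∈ l', Function.Surjective D) ∧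
        sumLaw η (m ++ l) = sumLaw η l' ∧
        l'.length = (m.filter (· ≠ 0)).length + l.length := by
  refine (sumLaw_absolutelyContinuous_or_forall_surjective h_below
    (hm.mono (List.subset_append_left m l))).imp_right fun h_surj =>
    ⟨m.filter (· ≠ 0) ++ l, fun D hD => ?_, ?_, List.length_append⟩
  · rcases List.mem_append.1 hD with hDm | hDl
    · obtain ⟨hDm, hD_ne⟩ := List.mem_filter.1 hDm
      exact h_surj D (List.mem_append_left l hDm) (of_decide_eq_true hD_ne)
    · exact hl D hDl
  · rw [sumLaw_append, sumLaw_append, sumLaw_filter_ne_zero]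

end SingularMass

section Descent

variable {Ω : Type*} [MeasurableSpace Ω] {d : ℕ} {P : Measure Ω}
  {N : Ω → ℕ} {A : ℕ → Ω → Matrix (Fin d) (Fin d) ℝ}
  {η : Measure (Fin d → ℝ)} [IsProbabilityMeasure η]
  {E : Type} [NormedAddCommGroup E] [InnerProductSpace ℝ E] [FiniteDimensional ℝ E]
  [MeasurableSpace E] [BorelSpace E]

lemma sumLaw_cons_apply_eq_lintegral (hN : Measurable N) (hA : ∀ i, Measurable (A i))
    (hη : smoothingTransform P N A η = η) (C : (Fin d → ℝ) →L[ℝ] E)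
    (l : List ((Fin d → ℝ) →L[ℝ] E)) {S : Set E} (hS : MeasurableSet S) :
    sumLaw η (C :: l) S = ∫⁻ ω, sumLaw η ((childMaps N A ω).map C.comp ++ l) S ∂P := by
  let g (y : E) : ℝ≥0∞ := ∫⁻ z, S.indicator 1 (y + z) ∂(sumLaw η l)
  have measurable_indicator : Measurable (S.indicator (1 : E → ℝ≥0∞)) :=
    measurable_one.indicator hS
  have measurable_g : Measurable g :=
    Measurable.lintegral_prod_right' (f := fun p : E × E => S.indicator (1 : E → ℝ≥0∞) (p.1 + p.2))
      (measurable_indicator.comp measurable_add)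
  have conv_apply (ν : Measure (Fin d → ℝ)) : ((ν.map C) ∗ sumLaw η l) S = ∫⁻ x, g (C x) ∂ν := by
    rw [← lintegral_indicator_one hS, Measure.lintegral_conv measurable_indicator,
      lintegral_map measurable_g C.continuous.measurable]
  rw [sumLaw, conv_apply, lintegral_eq_of_fixed (g := fun x => g (C x)) hN hA hη
    (measurable_g.comp C.continuous.measurable)]
  refine lintegral_congr fun ω => ?_
  rw [sumLaw_append, ← map_sumLaw, conv_apply]

lemma sumLaw_cons_apply_le [Nontrivial E] (hN : Measurable N) (hA : ∀ i, Measurable (A i))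
    (hzero : ∀ᵐ ω ∂P, ∀ i, N ω ≤ i → A i ω = 0) (h_active : ActivityCondition P A)
    (hη : smoothingTransform P N A η = η) (h_below : AbsContBelow η (Module.finrank ℝ E)) {k : ℕ}
    (h_above : ∀ l : List ((Fin d → ℝ) →L[ℝ] E), (∀ D ∈ l, Function.Surjective D) →
      k + 1 < l.length → sumLaw η l ≪ Measure.addHaar)
    {C : (Fin d → ℝ) →L[ℝ] E} (hC : Function.Surjective C) {l : List ((Fin d → ℝ) →L[ℝ] E)}
    (hl : ∀ D ∈ l, Function.Surjective D) (hlk : l.length = k) {S : Set E}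
    (hS : MeasurableSet S) (hS_null : (Measure.addHaar : Measure E) S = 0) (ξ : E) :
    sumLaw η (C :: l) S ≤ singularMass E η (k + 1) * P (twoLarge A (dotAdjoint C ξ))ᶜ := by
  classical
  have children_le : ∀ᵐ ω ∂P, sumLaw η ((childMaps N A ω).map C.comp ++ l) S ≤
      (twoLarge A (dotAdjoint C ξ))ᶜ.indicator (fun _ => singularMass E η (k + 1)) ω := by
    filter_upwards [hzero, h_active.one_le] with ω hω_zero hω_active
    have spans := spans_children hω_zero hω_active hC
    obtain ac | ⟨l', hl', law_eq, length_eq⟩ :=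
      sumLaw_append_absolutelyContinuous_or_exists h_below spans hl
    · exact (ac hS_null).trans_le zero_le
    rw [law_eq]
    by_cases long : k + 1 < l'.length
    · exact (h_above l' hl' long hS_null).trans_le zero_le
    have not_twoLarge : ω ∈ (twoLarge A (dotAdjoint C ξ))ᶜ := fun hω => by
      have := two_le_length_filter_children hω_zero hω
      omega
    have filter_length_pos := List.length_pos_iff.2 spans.filter_ne_zero.ne_nil
    rw [Set.indicator_of_mem not_twoLarge]
    exact sumLaw_le_singularMass hl' (by omega) hS hS_null
  rw [sumLaw_cons_apply_eq_lintegral hN hA hη C l hS]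
  exact (lintegral_mono_ae children_le).trans_eq
    (lintegral_indicator_const (measurableSet_twoLarge hA _).compl _)

variable [IsProbabilityMeasure P]

lemma singularMass_eq_zero [Nontrivial E] (hN : Measurable N) (hA : ∀ i, Measurable (A i))
    (hzero : ∀ᵐ ω ∂P, ∀ i, N ω ≤ i → A i ω = 0) (h_active : ActivityCondition P A)
    (hη : smoothingTransform P N A η = η) (h_below : AbsContBelow η (Module.finrank ℝ E)) {k : ℕ}
    (h_above : ∀ l : List ((Fin d → ℝ) →L[ℝ] E), (∀ D ∈ l, Function.Surjective D) →
      k + 1 < l.length → sumLaw η l ≪ Measure.addHaar) :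
    singularMass E η (k + 1) = 0 := by
  obtain ⟨p, R, hp, twoLarge_ge⟩ := h_active.exists_le_measureReal_twoLarge
  have contraction :
      singularMass E η (k + 1) ≤ singularMass E η (k + 1) * ENNReal.ofReal (1 - p) := by
    refine iSup₂_le fun ⟨l, hl, hlk⟩ ⟨S, hS, hS_null⟩ => ?_
    obtain ⟨C, l, rfl⟩ := List.exists_cons_of_length_eq_add_one hlk
    have hC : Function.Surjective C := hl C List.mem_cons_self
    obtain ⟨ξ, hξ⟩ := exists_le_l1norm_dotAdjoint hC R
    refine (sumLaw_cons_apply_le hN hA hzero h_active hη h_below h_above hC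
      (fun D hD => hl D (List.mem_cons_of_mem C hD)) (Nat.succ_injective hlk) hS hS_null ξ).trans ?_
    gcongr
    rw [← ofReal_measureReal, probReal_compl_eq_one_sub (measurableSet_twoLarge hA _)]
    exact ENNReal.ofReal_le_ofReal (by linarith [twoLarge_ge _ hξ])
  by_contra hne
  have ne_top : singularMass E η (k + 1) ≠ ∞ :=
    ((singularMass_le_one _).trans_lt ENNReal.one_lt_top).ne
  refine contraction.not_gt ?_
  calc singularMass E η (k + 1) * ENNReal.ofReal (1 - p) < singularMass E η (k + 1) * 1 :=
        ENNReal.mul_lt_mul_right hne ne_top (ENNReal.ofReal_lt_one.2 (by linarith))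
    _ = singularMass E η (k + 1) := mul_one _

lemma sumLaw_absolutelyContinuous_of_surjective [Nontrivial E] (hN : Measurable N)
    (hA : ∀ i, Measurable (A i)) (hzero : ∀ᵐ ω ∂P, ∀ i, N ω ≤ i → A i ω = 0)
    (h_active : ActivityCondition P A) (hη : smoothingTransform P N A η = η) {a C : ℝ} (ha : 0 < a)
    (h_decay : ∀ t ≠ 0, ‖chf η t‖ ≤ C * l1norm t ^ (-a))
    (h_below : AbsContBelow η (Module.finrank ℝ E)) {l : List ((Fin d → ℝ) →L[ℝ] E)}
    (hl : ∀ D ∈ l, Function.Surjective D) (hl_pos : 0 < l.length) :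
    sumLaw η l ≪ Measure.addHaar := by
  obtain ⟨K, hK⟩ := exists_nat_gt ((Module.finrank ℝ E : ℝ) / a)
  rw [div_lt_iff₀' ha] at hK
  -- Descending induction: sums of many terms are absolutely continuous by decay of the
  -- characteristic function, and `singularMass_eq_zero` removes one term at a time.
  suffices descent : ∀ l : List ((Fin d → ℝ) →L[ℝ] E), (∀ D ∈ l, Function.Surjective D) →
      0 < l.length → sumLaw η l ≪ Measure.addHaar from descent l hl hl_pos
  refine Nat.decreasingInduction (motive := fun k _ => ∀ l : List ((Fin d → ℝ) →L[ℝ] E),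
    (∀ D ∈ l, Function.Surjective D) → k < l.length → sumLaw η l ≪ Measure.addHaar)
    (fun k _ h_above l hl hkl => ?_) (fun l hl hKl => ?_) (Nat.zero_le K)
  · obtain hlk | hlk := (Nat.succ_le_of_lt hkl).eq_or_lt
    · refine Measure.AbsolutelyContinuous.mk fun S hS hS_null => ?_
      refine le_antisymm ((sumLaw_le_singularMass hl hlk.symm hS hS_null).trans_eq ?_) zero_le
      exact singularMass_eq_zero hN hA hzero h_active hη h_below h_above
    · exact h_above l hl hlk
  · exact sumLaw_absolutelyContinuous_of_length ha.le h_decay l hl (hK.trans (by gcongr))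

lemma absContBelow (hN : Measurable N) (hA : ∀ i, Measurable (A i))
    (hzero : ∀ᵐ ω ∂P, ∀ i, N ω ≤ i → A i ω = 0) (h_active : ActivityCondition P A)
    (hη : smoothingTransform P N A η = η) {a C : ℝ} (ha : 0 < a)
    (h_decay : ∀ t ≠ 0, ‖chf η t‖ ≤ C * l1norm t ^ (-a)) (n : ℕ) : AbsContBelow η n := by
  classical
  induction n with
  | zero => exact fun F _ _ _ _ _ hF => absurd hF (Nat.not_lt_zero _)
  | succ n ih =>
    intro F _ _ _ _ _ hF l hl
    have h_below : AbsContBelow η (Module.finrank ℝ F) := fun G _ _ _ _ _ hG =>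
      ih G (hG.trans_le (Nat.lt_succ_iff.1 hF))
    obtain _ | _ := subsingleton_or_nontrivial F
    · refine Measure.AbsolutelyContinuous.mk fun S _ hS_null => ?_
      rcases S.eq_empty_or_nonempty with rfl | hS
      · exact measure_empty
      · rw [Subsingleton.eq_univ_of_nonempty hS] at hS_null
        exact absurd hS_null (NeZero.ne _)
    obtain ac | ⟨l', hl', law_eq, length_eq⟩ :=
      sumLaw_append_absolutelyContinuous_or_exists (l := []) h_below hl (by simp)
    · rwa [List.append_nil] at ac
    rw [List.append_nil] at law_eq
    have filter_length_pos := List.length_pos_iff.2 hl.filter_ne_zero.ne_nil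
    rw [law_eq]
    exact sumLaw_absolutelyContinuous_of_surjective hN hA hzero h_active hη ha h_decay h_below hl'
      (by omega)

theorem absolutelyContinuous_of_decay (hN : Measurable N) (hA : ∀ i, Measurable (A i))
    (hzero : ∀ᵐ ω ∂P, ∀ i, N ω ≤ i → A i ω = 0) (h_active : ActivityCondition P A)
    (hη : smoothingTransform P N A η = η) {a C : ℝ} (ha : 0 < a)
    (h_decay : ∀ t ≠ 0, ‖chf η t‖ ≤ C * l1norm t ^ (-a)) : η ≪ volume := by
  let e : (Fin d → ℝ) ≃L[ℝ] EuclideanSpace ℝ (Fin d) := (EuclideanSpace.equiv (Fin d) ℝ).symm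
  have map_ac : η.map e ≪ Measure.addHaar := by
    rw [← ContinuousLinearEquiv.coe_coe, ← sumLaw_singleton]
    exact absContBelow hN hA hzero h_active hη ha h_decay _ (EuclideanSpace ℝ (Fin d))
      (Nat.lt_succ_self _) _ (spans_of_surjective List.mem_cons_self e.surjective)
  have symm_map_ac := map_ac.map e.symm.continuous.measurable
  rw [Measure.map_map e.symm.continuous.measurable e.continuous.measurable, e.symm_comp_self,
    Measure.map_id] at symm_map_ac
  have := e.symm.isAddHaarMeasure_map (Measure.addHaar : Measure (EuclideanSpace ℝ (Fin d)))
  exact symm_map_ac.trans (Measure.absolutelyContinuous_isAddHaarMeasure _ _)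

end Descent

/-! ### Rays in the support -/

section Support

variable {d : ℕ} {η : Measure (Fin d → ℝ)}

lemma dotProduct_eq_of_mem_support {t x : Fin d → ℝ} {c : ℝ} (h : ∀ᵐ x ∂η, t ⬝ᵥ x = c)
    (hx : x ∈ η.support) : t ⬝ᵥ x = c := by
  have isClosed_hyperplane : IsClosed {x : Fin d → ℝ | t ⬝ᵥ x = c} :=
    isClosed_eq (continuous_const.dotProduct continuous_id) continuous_const
  exact Measure.support_subset_of_isClosed isClosed_hyperplane h hx

lemma not_ae_dotProduct_eq_of_mem_support {v : Fin d → (Fin d → ℝ)} (hv : LinearIndependent ℝ v)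
    (h_zero : 0 ∈ η.support) (h_supp : ∀ i, v i ∈ η.support) {t : Fin d → ℝ} (ht : t ≠ 0) (c : ℝ) :
    ¬ ∀ᵐ x ∂η, t ⬝ᵥ x = c := by
  intro h
  have dotProduct_eq_zero (i : Fin d) : t ⬝ᵥ v i = 0 := by
    rw [dotProduct_eq_of_mem_support h (h_supp i), ← dotProduct_eq_of_mem_support h h_zero,
      dotProduct_zero]
  have span_eq_top : Submodule.span ℝ (Set.range v) = ⊤ :=
    hv.span_eq_top_of_card_eq_finrank' (by simp)
  have dotCLM_eq_zero : (dotCLM t : (Fin d → ℝ) →ₗ[ℝ] ℝ) = 0 :=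
    LinearMap.ext_on_range span_eq_top dotProduct_eq_zero
  exact ht (dotProduct_self_eq_zero.1 (LinearMap.congr_fun dotCLM_eq_zero t))

end Support

end Smoothing

end

theorem mainTheorem3_general {d : ℕ}
    {Ω : Type*} [MeasurableSpace Ω] (P : Measure Ω) [IsProbabilityMeasure P]
    (N : Ω → ℕ) (hN : Measurable N)
    (A : ℕ → Ω → Matrix (Fin d) (Fin d) ℝ) (hA : ∀ i, Measurable (A i))
    (hm : 0 < Smoothing.meanN P N) (hzero : ∀ᵐ ω ∂P, ∀ i, N ω ≤ i → A i ω = 0)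
    {s : ℝ} (hs_pos : 0 < s) (hs : s ∈ Smoothing.momentSet (Smoothing.intensity P N A))
    (hlt : Smoothing.mFun P N A s < 1)
    (h_active : Smoothing.ActivityCondition P A)
    {Ω' : Type*} [MeasurableSpace Ω'] (Q : Measure Ω') [IsProbabilityMeasure Q]
    (Z : Ω' → Fin d → ℝ) (hZ : Measurable Z)
    (hZ_fixed : Smoothing.smoothingTransform P N A (Q.map Z) = Q.map Z)
    (h_nondeg : ∀ t : Fin d → ℝ, t ≠ 0 → ∀ c : ℝ, ¬ ∀ᵐ ω ∂Q, t ⬝ᵥ Z ω = c) :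
    (∃ a C : ℝ, 0 < a ∧ 0 < C ∧ ∀ t : Fin d → ℝ, t ≠ 0 →
        ‖∫ ω, Complex.exp (Complex.I * ((t ⬝ᵥ Z ω : ℝ) : ℂ)) ∂Q‖
          ≤ C * Smoothing.l1norm t ^ (-a)) ∧
      Q.map Z ≪ volume := by
  have : IsProbabilityMeasure (Q.map Z) := Measure.isProbabilityMeasure_map hZ.aemeasurable
  obtain ⟨ρ, K, w, hw⟩ := Smoothing.exists_isLyapunov hN hA hm hs_pos hs hlt
  obtain ⟨a, C, ha, hC, h_decay⟩ := Smoothing.exists_norm_chf_le_mul_rpow_neg hN hA hzero h_active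
    hZ_fixed hw fun t ht c h => h_nondeg t ht c (ae_of_ae_map hZ.aemeasurable h)
  exact ⟨⟨a, C, ha, hC, fun t ht => Smoothing.chf_map hZ.aemeasurable t ▸ h_decay t ht⟩,
    Smoothing.absolutelyContinuous_of_decay hN hA hzero h_active hZ_fixed ha h_decay⟩

theorem mainTheorem3 {d : ℕ}
    {Ω : Type*} [MeasurableSpace Ω] (P : Measure Ω) [IsProbabilityMeasure P]
    (N : Ω → ℕ) (hN : Measurable N)
    (A : ℕ → Ω → Matrix (Fin d) (Fin d) ℝ) (hA : ∀ i, Measurable (A i))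
    (h_branch : Smoothing.BranchingCondition P N A)
    (h_alpha : Smoothing.AlphaCondition P N A)
    (h_active : Smoothing.ActivityCondition P A)
    {Ω' : Type*} [MeasurableSpace Ω'] (Q : Measure Ω') [IsProbabilityMeasure Q]
    (Z : Ω' → Fin d → ℝ) (hZ : Measurable Z)
    (hZ_nonneg : ∀ᵐ ω ∂Q, 0 ≤ Z ω)
    (hZ_fixed : Smoothing.smoothingTransform P N A (Q.map Z) = Q.map Z)
    (hZ_zero : Q {ω | Z ω = 0} = 0) :
    ((∀ t : Fin d → ℝ, t ≠ 0 → ∀ c : ℝ, ¬ ∀ᵐ ω ∂Q, t ⬝ᵥ Z ω = c) →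
      ∃ a C : ℝ, 0 < a ∧ 0 < C ∧ ∀ t : Fin d → ℝ, t ≠ 0 →
        ‖∫ ω, Complex.exp (Complex.I * ((t ⬝ᵥ Z ω : ℝ) : ℂ)) ∂Q‖
          ≤ C * Smoothing.l1norm t ^ (-a)) ∧
    ((∃ v : Fin d → (Fin d → ℝ), LinearIndependent ℝ v ∧
        (∀ i, 0 ≤ v i ∧ v i ≠ 0) ∧
        ∀ i, ∀ s : ℝ, 0 ≤ s → s • v i ∈ (Q.map Z).support) →
      Q.map Z ≪ volume) := by
  obtain ⟨s, hs_pos, hs, hlt⟩ := h_alpha.exists_mFun_lt_one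
  have general := mainTheorem3_general P N hN A hA (zero_lt_one.trans h_branch.one_lt_mean)
    h_branch.eq_zero hs_pos hs hlt h_active Q Z hZ hZ_fixed
  refine ⟨fun h_nondeg => (general h_nondeg).1, fun ⟨v, hv, _, h_rays⟩ => (general ?_).2⟩
  intro t ht c h
  have h_zero : 0 ∈ (Q.map Z).support := by
    obtain ⟨i, -⟩ := Function.ne_iff.1 ht
    simpa only [zero_smul] using h_rays i 0 le_rfl
  exact Smoothing.not_ae_dotProduct_eq_of_mem_support hv h_zero
    (fun i => by simpa only [one_smul] using h_rays i 1 zero_le_one) ht c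
    ((ae_map_iff hZ.aemeasurable (measurableSet_eq_fun (by fun_prop) measurable_const)).2 h)
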